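/- **Notation.** Every infinite series over $n\ge 1$ is understood as the limit of its partial sums (many of them converge only conditionally); a nested series over $0<n_1<\cdots<n_r$ is summed with the largest variable $n_r$ outermost, i.e. it is the limit as $N\to\infty$ of the finite sums over $0<n_1<\cdots<n_r\le N$. Let $$\bar\zeta(k)=\sum_{n=1}^\infty\frac{(-1)^{n-1}}{n^k}\quad(k\ge 1),\qquad \bar\zeta(0)=\tfrac12 .$$ For positive integers $k_1,\dots,k_r$ let $$\overline{T}(k_1,\dots,k_r)=2^r\sum_{0<n_1<\cdots<n_r}\frac{(-1)^{n_r}}{(2n_1-1)^{k_1}(2n_2-2)^{k_2}\cdots(2n_r-r)^{k_r}},$$ and let $$W(w,r)=\sum_{\substack{k_1+\cdots+k_r=w\\ k_1,\dots,k_r\ge 1}}\overline{T}(k_1,\dots,k_r).$$ Let $\{1\}_r$ be the sequence of $r$ ones, let $T_n(\{1\}_0)=S_n(\{1\}_0)=1$, and for $r\ge1$ put $$T_n(\{1\}_r)=\sum\frac{2^r}{(2n_1-1)(2n_2)(2n_3-1)(2n_4)\cdots}\quad(r\text{ factors}),$$ the sum being over positive integers $n_1\le n_2<n_3\le n_4<\cdots$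 ($r$ variables) with $n_r\le n$ if $r$ is odd and $n_r<n$ if $r$ is even, and $$S_n(\{1\}_r)=\sum\frac{2^r}{(2n_1)(2n_2-1)(2n_3)(2n_4-1)\cdots}\quad(r\text{ factors}),$$ the sum being over positive integers $n_1<n_2\le n_3<n_4\le\cdots$ ($r$ variables) with $n_r<n$ if $r$ is odd and $n_r\le n$ if $r$ is even (empty sums are $0$). **Theorem.** Let $m$ and $p$ be positive integers. Then all the series occurring below (including those defining the values $\bar\zeta$ and $\overline{T}$) converge, and $$W(2p+2m-1,2m)=2(-1)^m\sum_{j=0}^{p-1}\bar\zeta(2p-2-2j)\sum_{n=1}^\infty\frac{T_n(\{1\}_{2m-1})T_n(\{1\}_{2j+1})}{n}(-1)^n,$$ $$\begin{aligned}W(2p+2m-2,2m)={}&2(-1)^m\sum_{j=0}^{p-2}\bar\zeta(2p-3-2j)\sum_{n=1}^\infty\frac{T_n(\{1\}_{2m-1})T_n(\{1\}_{2j+1})}{n}(-1)^n\\&+(-1)^m\sum_{n=1}^\infty\frac{T_n(\{1\}_{2m-1})S_n(\{1\}_{2p-2})}{n}(-1)^n,\end{aligned}$$ $$\begin{aligned}W(2p+2m-2,2m-1)={}&4(-1)^{m-1}\sum_{j=0}^{p-1}\bar\zeta(2p-1-2j)\sum_{n=1}^\infty\frac{T_n(\{1\}_{2m-2})T_n(\{1\}_{2j})}{2n-1}(-1)^n\\&+2(-1)^{m-1}\sum_{n=1}^\infty\frac{T_n(\{1\}_{2m-2})S_n(\{1\}_{2p-1})}{2n-1}(-1)^n,\end{aligned}$$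 $$W(2p+2m-3,2m-1)=4(-1)^{m-1}\sum_{j=0}^{p-1}\bar\zeta(2p-2-2j)\sum_{n=1}^\infty\frac{T_n(\{1\}_{2m-2})T_n(\{1\}_{2j})}{2n-1}(-1)^n .$$ -/

import Mathlib

open Filter Topology

noncomputable section

namespace AltMTV

/-! Many of the series below converge only conditionally, so every infinite series
`∑_{n ≥ 1} a n` is the limit of its partial sums `∑_{n = 1}^{N} a n`. -/

/-- The series `∑_{n ≥ 1} a n` converges. -/
def SeriesConverges (a : ℕ → ℝ) : Prop :=
  ∃ s : ℝ, Tendsto (fun N : ℕ => ∑ n ∈ Finset.Icc 1 N, a n) atTop (𝓝 s)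

/-- The value of the series `∑_{n ≥ 1} a n`, the limit of its partial sums
(meaningful when `SeriesConverges a`). -/
def series (a : ℕ → ℝ) : ℝ :=
  limUnder atTop (fun N : ℕ => ∑ n ∈ Finset.Icc 1 N, a n)

/-- The general term `(-1)^(n-1) / n^s` of the alternating zeta series. -/
def zetaBarTerm (s n : ℕ) : ℝ := (-1) ^ (n - 1) / (n : ℝ) ^ s

/-- The alternating Riemann zeta value, with the convention that its value at `0` is `1/2`. -/
def zetaBar (s : ℕ) : ℝ := if s = 0 then 1 / 2 else series (zetaBarTerm s)

/-- `I(w, r)`: the indices `(k_1, …, k_r)` of positive integers of weight `w` and depth `r`. -/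
def indexSet (w r : ℕ) : Finset (Fin r → ℕ) :=
  (Finset.Nat.antidiagonalTuple r w).filter (fun k => ∀ i, 0 < k i)

/-- The index `(1, …, 1)` of depth `r`. -/
def ones (r : ℕ) : Fin r → ℕ := fun _ => 1

/-- The finite nested sum
`2^r ∑_{0 < n_1 < ⋯ < n_r ≤ N} 1 / ((2 n_1 - 1)^{k_1} (2 n_2 - 2)^{k_2} ⋯ (2 n_r - r)^{k_r})`,
written by summing over the largest summation variable last. -/
def truncT : (r : ℕ) → (Fin r → ℕ) → ℕ → ℝ
  | 0, _, _ => 1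
  | r + 1, k, N => ∑ n ∈ Finset.Icc 1 N,
      2 * truncT r (Fin.init k) (n - 1) / (2 * (n : ℝ) - ((r + 1 : ℕ) : ℝ)) ^ k (Fin.last r)

/-- The general term, indexed by the largest summation variable `n = n_r`, of the series
`2^r ∑_{0 < n_1 < ⋯ < n_r} (-1)^{n_r} / ((2 n_1 - 1)^{k_1} ⋯ (2 n_r - r)^{k_r})`.
(The value for the empty index plays no role.) -/
def altTTerm : (r : ℕ) → (Fin r → ℕ) → ℕ → ℝ
  | 0, _, _ => 0
  | r + 1, k, n =>
      2 * (-1) ^ n * truncT r (Fin.init k) (n - 1) /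
        (2 * (n : ℝ) - ((r + 1 : ℕ) : ℝ)) ^ k (Fin.last r)

/-- The alternating multiple `T`-value whose last argument alone is barred:
`2^r ∑_{0 < n_1 < ⋯ < n_r} (-1)^{n_r} / ((2 n_1 - 1)^{k_1} ⋯ (2 n_r - r)^{k_r})`. -/
def altT (r : ℕ) (k : Fin r → ℕ) : ℝ := series (altTTerm r k)

/-- `W(w, r)`, the sum of the alternating multiple `T`-values over all indices of weight `w` and
depth `r`. -/
def W (w r : ℕ) : ℝ := ∑ k ∈ indexSet w r, altT r k

/-- The multiple `T`-harmonic sum `T_n(k_1, …, k_r)`: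
`2^r` times the sum of `1 / ((2 n_1 - 1)^{k_1} (2 n_2)^{k_2} (2 n_3 - 1)^{k_3} (2 n_4)^{k_4} ⋯)`
over `0 < n_1 ≤ n_2 < n_3 ≤ n_4 < ⋯` (`r` variables), with `n_r ≤ n` if `r` is odd and `n_r < n`
if `r` is even; it is `1` for the empty index. The recursion splits off the last variable `l`. -/
def tSum : (r : ℕ) → (Fin r → ℕ) → ℕ → ℝ
  | 0, _, _ => 1
  | r + 1, k, n =>
      if Odd (r + 1) then
        ∑ l ∈ Finset.Icc 1 n, 2 * tSum r (Fin.init k) l / (2 * (l : ℝ) - 1) ^ k (Fin.last r)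
      else
        ∑ l ∈ Finset.Ico 1 n, 2 * tSum r (Fin.init k) l / (2 * (l : ℝ)) ^ k (Fin.last r)

/-- The multiple `S`-harmonic sum `S_n(k_1, …, k_r)`:
`2^r` times the sum of `1 / ((2 n_1)^{k_1} (2 n_2 - 1)^{k_2} (2 n_3)^{k_3} (2 n_4 - 1)^{k_4} ⋯)`
over `0 < n_1 < n_2 ≤ n_3 < n_4 ≤ ⋯` (`r` variables), with `n_r < n` if `r` is odd and `n_r ≤ n`
if `r` is even; it is `1` for the empty index. The recursion splits off the last variable `l`. -/
def sSum : (r : ℕ) → (Fin r → ℕ) → ℕ → ℝ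
  | 0, _, _ => 1
  | r + 1, k, n =>
      if Odd (r + 1) then
        ∑ l ∈ Finset.Ico 1 n, 2 * sSum r (Fin.init k) l / (2 * (l : ℝ)) ^ k (Fin.last r)
      else
        ∑ l ∈ Finset.Icc 1 n, 2 * sSum r (Fin.init k) l / (2 * (l : ℝ) - 1) ^ k (Fin.last r)

/-- The term `T_n({1}_a) T_n({1}_b) / n · (-1)^n`. -/
def termTTEven (a b n : ℕ) : ℝ := tSum a (ones a) n * tSum b (ones b) n / (n : ℝ) * (-1) ^ n

/-- The term `T_n({1}_a) S_n({1}_b) / n · (-1)^n`. -/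
def termTSEven (a b n : ℕ) : ℝ := tSum a (ones a) n * sSum b (ones b) n / (n : ℝ) * (-1) ^ n

/-- The term `T_n({1}_a) T_n({1}_b) / (2n-1) · (-1)^n`. -/
def termTTOdd (a b n : ℕ) : ℝ :=
  tSum a (ones a) n * tSum b (ones b) n / (2 * (n : ℝ) - 1) * (-1) ^ n

/-- The term `T_n({1}_a) S_n({1}_b) / (2n-1) · (-1)^n`. -/
def termTSOdd (a b n : ℕ) : ℝ :=
  tSum a (ones a) n * sSum b (ones b) n / (2 * (n : ℝ) - 1) * (-1) ^ n

end AltMTV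

end

open AltMTV

/-! Both sides are expansions of one integral. Summing over all indices of depth `r + 1` and weight
`r + 1 + q` gives, up to the sign `(-1)^(r+1)`, the integral over `[0, 1]` of `(π/2 - 2 arctan t)^r
/ r! · (-log t)^q / q! · 2 dt / (1 + t²)`; this is `W_eq_coeff`. A variable `X` records `q`, so that
summing over exponents replaces `a^(-k)` by `1 / (a - X)`, and integration by parts becomes
multiplication by `X` (`moments_add_coord_mul`).

Put `u = (1 - t) / (1 + t)`. Then `π/2 - 2 arctan t = 2 arctan u`, `-log t = log ((1 + u) / (1 -
u))` and `2 dt / (1 + t²)` becomes `-2 du / (1 + u²)`. The primitive `(2 arctan u)^(r+1) / (r+1)!`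
is expanded in powers of `u` and integrated term by term against the logarithm
(`tendsto_sum_arctanCoeff`).

The Taylor coefficients and the moments of `k u^(k-1)` obey the same second order recursion up to a
sign `ε`, solved by `recSeq`. For `ε = -1` it yields the signed sums `T_n`; for `ε = 1` its two
fundamental solutions yield `T_n` and `S_n`, and the first of them is multiplied by the generating
series of the values `2 ζ̄(q)` (`cayleyMoment_eq`). In a given degree these coefficients vanish for
one parity of `k`, which separates the four formulas (`W_even`, `W_odd`).

Convergence is conditional throughout, so every limit exchange rests on polylogarithmic bounds
beating `1 / n`. -/

noncomputable section

namespace AltMTV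

/-! ### Polylogarithmic growth and an alternating series test -/

/-- The logarithmic gauge used to measure slow growth. -/
def gauge (n : ℕ) : ℝ := 1 + Real.log (n + 1)

lemma one_le_gauge (n : ℕ) : 1 ≤ gauge n := by
  unfold gauge
  have : 0 ≤ Real.log ((n : ℝ) + 1) := Real.log_nonneg (by linarith [(n.cast_nonneg : (0 : ℝ) ≤ n)])
  linarith

lemma gauge_mono : Monotone gauge := by
  intro a b h
  unfold gauge
  have : ((a : ℝ)) ≤ b := by exact_mod_cast h
  have := Real.log_le_log (by positivity : (0 : ℝ) < a + 1) (by linarith : (a : ℝ) + 1 ≤ b + 1)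
  linarith

lemma gauge_succ_le (n : ℕ) : gauge (n + 1) ≤ 2 * gauge n := by
  unfold gauge
  have h1 : Real.log (((n + 1 : ℕ) : ℝ) + 1) ≤ Real.log (2 * ((n : ℝ) + 1)) := by
    apply Real.log_le_log (by positivity)
    push_cast
    linarith [(n.cast_nonneg : (0 : ℝ) ≤ n)]
  rw [Real.log_mul (by norm_num) (by positivity)] at h1
  have h2 : 0 ≤ Real.log ((n : ℝ) + 1) :=
    Real.log_nonneg (by linarith [(n.cast_nonneg : (0 : ℝ) ≤ n)])
  have h3 : Real.log 2 ≤ 1 := by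
    have := Real.log_le_sub_one_of_pos (by norm_num : (0 : ℝ) < 2)
    linarith
  linarith

lemma sum_inv_le_gauge (n : ℕ) : ∑ l ∈ Finset.Icc 1 n, (1 : ℝ) / l ≤ gauge n := by
  have h := harmonic_le_one_add_log n
  have h2 : ((harmonic n : ℚ) : ℝ) = ∑ l ∈ Finset.Icc 1 n, (1 : ℝ) / l := by
    rw [harmonic_eq_sum_Icc]
    push_cast
    simp
  rw [← h2]
  refine h.trans ?_
  unfold gauge
  rcases Nat.eq_zero_or_pos n with rfl | hn
  · simp
  · have : (0 : ℝ) < n := by exact_mod_cast hn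
    have := Real.log_le_log this (by linarith : (n : ℝ) ≤ n + 1)
    linarith

/-- Sequences of at most polylogarithmic growth. -/
def Slow (a : ℕ → ℝ) : Prop := ∃ d : ℕ, ∃ C : ℝ, 0 ≤ C ∧ ∀ n, |a n| ≤ C * gauge n ^ d

lemma Slow.of_bounded {a : ℕ → ℝ} (C : ℝ) (h : ∀ n, |a n| ≤ C) : Slow a :=
  ⟨0, C, (abs_nonneg _).trans (h 0), fun n => by simpa using h n⟩

lemma Slow.const (c : ℝ) : Slow fun _ => c := Slow.of_bounded |c| fun _ => le_rfl

lemma Slow.mono {a b : ℕ → ℝ} (hb : Slow b) (h : ∀ n, |a n| ≤ |b n|) : Slow a := by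
  obtain ⟨d, C, hC, hd⟩ := hb
  exact ⟨d, C, hC, fun n => (h n).trans (hd n)⟩

lemma Slow.congr' {a b : ℕ → ℝ} (hb : Slow b) (h : ∀ᶠ n in atTop, a n = b n) : Slow a := by
  obtain ⟨d, C, hC, hd⟩ := hb
  obtain ⟨N, hN⟩ := eventually_atTop.1 h
  refine ⟨d, C + ∑ i ∈ Finset.range N, |a i|, by positivity, fun n => ?_⟩
  have hg : 1 ≤ gauge n ^ d := one_le_pow₀ (one_le_gauge n)
  have hs : 0 ≤ ∑ i ∈ Finset.range N, |a i| := by positivity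
  by_cases hn : N ≤ n
  · rw [hN n hn]
    refine (hd n).trans ?_
    gcongr
    linarith
  · have h1 : |a n| ≤ ∑ i ∈ Finset.range N, |a i| :=
      Finset.single_le_sum (f := fun i => |a i|) (fun _ _ => abs_nonneg _)
        (Finset.mem_range.2 (not_le.1 hn))
    nlinarith

lemma Slow.add {a b : ℕ → ℝ} (ha : Slow a) (hb : Slow b) : Slow fun n => a n + b n := by
  obtain ⟨d, C, hC, hd⟩ := ha
  obtain ⟨e, D, hD, he⟩ := hb
  refine ⟨d + e, C + D, by positivity, fun n => ?_⟩
  have hg := one_le_gauge n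
  calc |a n + b n| ≤ |a n| + |b n| := abs_add_le _ _
    _ ≤ C * gauge n ^ d + D * gauge n ^ e := add_le_add (hd n) (he n)
    _ ≤ C * gauge n ^ (d + e) + D * gauge n ^ (d + e) := by
        gcongr <;> first | exact hg | omega
    _ = _ := by ring

lemma Slow.mul {a b : ℕ → ℝ} (ha : Slow a) (hb : Slow b) : Slow fun n => a n * b n := by
  obtain ⟨d, C, hC, hd⟩ := ha
  obtain ⟨e, D, hD, he⟩ := hb
  refine ⟨d + e, C * D, by positivity, fun n => ?_⟩
  have hg : 0 ≤ gauge n := zero_le_one.trans (one_le_gauge n)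
  calc |a n * b n| = |a n| * |b n| := abs_mul _ _
    _ ≤ (C * gauge n ^ d) * (D * gauge n ^ e) := by
        gcongr
        · exact hd n
        · exact he n
    _ = _ := by ring

lemma Slow.const_mul {a : ℕ → ℝ} (ha : Slow a) (c : ℝ) : Slow fun n => c * a n :=
  (Slow.const c).mul ha

lemma Slow.sum {ι : Type*} (s : Finset ι) {a : ι → ℕ → ℝ} (h : ∀ i ∈ s, Slow (a i)) :
    Slow fun n => ∑ i ∈ s, a i n := by
  classical
  induction s using Finset.induction_on with
  | empty => simpa using Slow.const 0
  | insert i s hi ih =>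
    simp only [Finset.sum_insert hi]
    exact (h i (by simp)).add (ih fun j hj => h j (by simp [hj]))

lemma Slow.succ {a : ℕ → ℝ} (ha : Slow a) : Slow fun n => a (n + 1) := by
  obtain ⟨d, C, hC, hd⟩ := ha
  refine ⟨d, C * 2 ^ d, by positivity, fun n => (hd (n + 1)).trans ?_⟩
  rw [mul_assoc, ← mul_pow]
  have := one_le_gauge (n + 1)
  gcongr
  exact gauge_succ_le n

lemma Slow.pred {a : ℕ → ℝ} (ha : Slow a) : Slow fun n => a (n - 1) := by
  obtain ⟨d, C, hC, hd⟩ := ha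
  refine ⟨d, C, hC, fun n => (hd (n - 1)).trans ?_⟩
  have := one_le_gauge (n - 1)
  gcongr
  exact gauge_mono (Nat.sub_le n 1)

/-- A harmonic sum costs only one more power of the gauge, so nested sums of any depth stay
polylogarithmic. -/
lemma Slow.sum_div {a : ℕ → ℝ} (ha : Slow a) : Slow fun n => ∑ l ∈ Finset.Icc 1 n, a l / l := by
  obtain ⟨d, C, hC, hd⟩ := ha
  refine ⟨d + 1, C, hC, fun n => ?_⟩
  calc |∑ l ∈ Finset.Icc 1 n, a l / l| ≤ ∑ l ∈ Finset.Icc 1 n, |a l / l| :=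
        Finset.abs_sum_le_sum_abs _ _
    _ ≤ ∑ l ∈ Finset.Icc 1 n, (C * gauge n ^ d) * (1 / l) := by
        refine Finset.sum_le_sum fun l hl => ?_
        rw [abs_div, Nat.abs_cast, div_eq_mul_one_div]
        gcongr
        refine (hd l).trans ?_
        have := one_le_gauge l
        gcongr
        exact gauge_mono (Finset.mem_Icc.1 hl).2
    _ = (C * gauge n ^ d) * ∑ l ∈ Finset.Icc 1 n, (1 : ℝ) / l := by rw [Finset.mul_sum]
    _ ≤ (C * gauge n ^ d) * gauge n := by
        have := one_le_gauge n
        gcongr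
        exact sum_inv_le_gauge n
    _ = _ := by ring

lemma gauge_pow_isLittleO (d : ℕ) {s : ℝ} (hs : 0 < s) :
    (fun n => gauge n ^ d) =o[atTop] fun n : ℕ => ((n : ℝ) + 1) ^ s := by
  have h0 : Tendsto (fun n : ℕ => (n : ℝ) + 1) atTop atTop :=
    tendsto_atTop_add_const_right _ _ tendsto_natCast_atTop_atTop
  have h1 := (isLittleO_log_rpow_rpow_atTop (d : ℝ) hs).comp_tendsto h0
  refine Asymptotics.IsBigO.trans_isLittleO ?_ h1
  have h2 : (fun n => gauge n) =O[atTop] fun n : ℕ => Real.log ((n : ℝ) + 1) := by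
    have h3 : (fun _ : ℕ => (1 : ℝ)) =O[atTop] fun n : ℕ => Real.log ((n : ℝ) + 1) := by
      refine (Asymptotics.isLittleO_const_left.2 (Or.inr ?_)).isBigO
      exact tendsto_norm_atTop_atTop.comp (Real.tendsto_log_atTop.comp h0)
    exact h3.add (Asymptotics.isBigO_refl _ _)
  simpa [Function.comp_def] using h2.pow d

lemma Slow.tendsto_div {a : ℕ → ℝ} (ha : Slow a) :
    Tendsto (fun n : ℕ => a n / (n + 1)) atTop (𝓝 0) := by
  obtain ⟨d, C, hC, hd⟩ := ha
  have h := (gauge_pow_isLittleO d one_pos).tendsto_div_nhds_zero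
  have h2 : Tendsto (fun n : ℕ => C * (gauge n ^ d / ((n : ℝ) + 1) ^ (1 : ℝ))) atTop (𝓝 0) := by
    simpa using h.const_mul C
  refine squeeze_zero_norm (fun n => ?_) h2
  rw [Real.rpow_one, Real.norm_eq_abs, abs_div, abs_of_pos (by positivity : (0 : ℝ) < n + 1),
    ← mul_div_assoc]
  gcongr
  exact hd n

/-- The polylogarithm is absorbed by `(n + 1)^(1/2)`, leaving the summable exponent `3/2`. -/
lemma Slow.summable_div_sq {a : ℕ → ℝ} (ha : Slow a) :
    Summable fun n : ℕ => a n / ((n : ℝ) + 1) ^ 2 := by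
  obtain ⟨d, C, hC, hd⟩ := ha
  have h := (gauge_pow_isLittleO d (by norm_num : (0 : ℝ) < 1 / 2)).isBigO
  have hs : Summable fun n : ℕ => 1 / ((n : ℝ) + 1) ^ (3 / 2 : ℝ) := by
    have := (summable_nat_add_iff 1).2
      (Real.summable_one_div_nat_rpow.2 (by norm_num : (1 : ℝ) < 3 / 2))
    simpa using this
  refine summable_of_isBigO_nat hs ?_
  have h1 : a =O[atTop] fun n : ℕ => ((n : ℝ) + 1) ^ (1 / 2 : ℝ) := by
    refine Asymptotics.IsBigO.trans ?_ h
    refine Asymptotics.IsBigO.of_bound C (Eventually.of_forall fun n => ?_)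
    rw [Real.norm_eq_abs, Real.norm_eq_abs,
      abs_of_nonneg (pow_nonneg (zero_le_one.trans (one_le_gauge n)) d)]
    exact hd n
  have h2 := h1.mul (Asymptotics.isBigO_refl (fun n : ℕ => 1 / ((n : ℝ) + 1) ^ 2) atTop)
  refine (h2.congr_left fun n => by ring).congr_right fun n => ?_
  have hp : (0 : ℝ) < n + 1 := by positivity
  rw [← Real.rpow_natCast _ 2, mul_one_div, ← Real.rpow_sub hp, one_div ((_ : ℝ) ^ (3 / 2 : ℝ)),
    ← Real.rpow_neg_one (_ ^ _),
    ← Real.rpow_mul hp.le]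
  norm_num

/-- Slowly growing sequences whose increments are of size `O(polylog n / n)`. -/
def SlowVar (a : ℕ → ℝ) : Prop := Slow a ∧ Slow fun n => (n : ℝ) * (a (n + 1) - a n)

lemma SlowVar.const (c : ℝ) : SlowVar fun _ => c :=
  ⟨Slow.const c, by simpa using Slow.const 0⟩

lemma SlowVar.congr' {a b : ℕ → ℝ} (hb : SlowVar b) (h : ∀ᶠ n in atTop, a n = b n) :
    SlowVar a := by
  refine ⟨hb.1.congr' h, hb.2.congr' ?_⟩
  filter_upwards [h, (tendsto_add_atTop_nat 1).eventually h] with n h1 h2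
  rw [h1, h2]

lemma SlowVar.add {a b : ℕ → ℝ} (ha : SlowVar a) (hb : SlowVar b) :
    SlowVar fun n => a n + b n :=
  ⟨ha.1.add hb.1, by convert ha.2.add hb.2 using 2; ring⟩

lemma SlowVar.mul {a b : ℕ → ℝ} (ha : SlowVar a) (hb : SlowVar b) :
    SlowVar fun n => a n * b n :=
  ⟨ha.1.mul hb.1, by convert (ha.2.mul hb.1.succ).add (ha.1.mul hb.2) using 2; ring⟩

lemma SlowVar.pow {a : ℕ → ℝ} (ha : SlowVar a) (k : ℕ) : SlowVar fun n => a n ^ k := by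
  induction k with
  | zero => simpa using SlowVar.const 1
  | succ k ih => simpa only [pow_succ] using ih.mul ha

lemma SlowVar.sum_div {a : ℕ → ℝ} (ha : Slow a) :
    SlowVar fun n => ∑ l ∈ Finset.Icc 1 n, a l / l := by
  refine ⟨ha.sum_div, ha.succ.mono fun n => ?_⟩
  beta_reduce
  rw [Finset.sum_Icc_succ_top (by omega), add_sub_cancel_left, mul_div_assoc', mul_comm,
    mul_div_assoc, abs_mul]
  refine mul_le_of_le_one_right (abs_nonneg _) ?_
  rw [abs_of_nonneg (by positivity)]
  push_cast
  exact (div_le_one (by positivity)).2 (by linarith)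

lemma SlowVar.pred {a : ℕ → ℝ} (ha : SlowVar a) : SlowVar fun n => a (n - 1) := by
  refine ⟨ha.1.pred, ?_⟩
  refine (ha.2.add (ha.1.succ.add (ha.1.const_mul (-1)))).pred.congr' ?_
  filter_upwards [eventually_ge_atTop 1] with n hn
  obtain ⟨m, rfl⟩ := Nat.exists_eq_add_of_le hn
  simp only [Nat.add_sub_cancel, add_comm 1 m]
  push_cast
  ring

lemma slow_inv_linear (j : ℕ) : Slow fun n : ℕ => 1 / (2 * (n : ℝ) - j) := by
  refine Slow.of_bounded 1 fun n => ?_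
  have h : (2 * (n : ℝ) - j) = ((2 * n - j : ℤ) : ℝ) := by push_cast; ring
  rw [h, abs_div, abs_one]
  -- The denominator is an integer: it is either zero, and the quotient is then `0` by convention,
  -- or at least `1` in absolute value.
  rcases eq_or_ne (2 * n - j : ℤ) 0 with h0 | h0
  · rw [h0]; simp
  · have : (1 : ℝ) ≤ |((2 * n - j : ℤ) : ℝ)| := by exact_mod_cast Int.one_le_abs h0
    exact (div_le_one (by linarith)).2 this

lemma slow_ratio_linear (j : ℕ) : Slow fun n : ℕ => (n : ℝ) / (2 * (n : ℝ) - j) := by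
  refine ((Slow.const (1 / 2)).add ((slow_inv_linear j).const_mul (j / 2))).congr' ?_
  filter_upwards [eventually_gt_atTop j] with n hn
  have hn' : (j : ℝ) < n := by exact_mod_cast hn
  have h0 : 2 * (n : ℝ) - j ≠ 0 := by
    have : (0 : ℝ) ≤ n := n.cast_nonneg
    linarith
  rw [div_eq_iff h0, add_mul, mul_assoc, one_div_mul_cancel h0]
  ring

lemma slowVar_inv_linear (j : ℕ) : SlowVar fun n : ℕ => 1 / (2 * (n : ℝ) - j) := by
  refine ⟨slow_inv_linear j, ?_⟩
  refine (((slow_ratio_linear j).mul (slow_inv_linear j).succ).const_mul (-2)).congr' ?_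
  filter_upwards [eventually_gt_atTop j] with n hn
  have hn' : (j : ℝ) < n := by exact_mod_cast hn
  have h00 : (0 : ℝ) ≤ n := n.cast_nonneg
  have h0 : 2 * (n : ℝ) - j ≠ 0 := by linarith
  have h1 : 2 * ((n : ℝ) + 1) - j ≠ 0 := by linarith
  push_cast
  rw [div_sub_div _ _ h1 h0, div_mul_div_comm, mul_div_assoc', mul_div_assoc', div_eq_div_iff
    (mul_ne_zero h1 h0) (mul_ne_zero h0 h1)]
  ring

lemma slowVar_ratio_linear (j : ℕ) : SlowVar fun n : ℕ => (n : ℝ) / (2 * (n : ℝ) - j) := by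
  refine ((SlowVar.const (1 / 2)).add
    ((SlowVar.const (j / 2)).mul (slowVar_inv_linear j))).congr' ?_
  filter_upwards [eventually_gt_atTop j] with n hn
  have hn' : (j : ℝ) < n := by exact_mod_cast hn
  have h0 : 2 * (n : ℝ) - j ≠ 0 := by
    have : (0 : ℝ) ≤ n := n.cast_nonneg
    linarith
  rw [div_eq_iff h0, add_mul, mul_assoc, one_div_mul_cancel h0]
  ring

/-- Doubling the sum and pairing neighbours replaces the terms by their differences, which are
absolutely summable in the application. -/
lemma two_mul_sum_alternating (b : ℕ → ℝ) (h0 : b 0 = 0) (N : ℕ) :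
    2 * ∑ n ∈ Finset.Icc 1 N, (-1) ^ n * b n =
      (-1) ^ N * b N + ∑ n ∈ Finset.range N, (-1) ^ (n + 1) * (b (n + 1) - b n) := by
  induction N with
  | zero => simp [h0]
  | succ N ih =>
    rw [Finset.sum_Icc_succ_top (by omega), mul_add, ih, Finset.sum_range_succ]
    ring

/-- A Dirichlet-type test for alternating series. -/
lemma SlowVar.converges {a : ℕ → ℝ} (ha : SlowVar a) :
    SeriesConverges fun n => (-1) ^ n * (a n / n) := by
  set b : ℕ → ℝ := fun n => a n / n with hb
  have hinv : Slow fun n : ℕ => 1 / (n : ℝ) := by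
    refine ((slow_inv_linear 0).const_mul 2).congr' (Eventually.of_forall fun n => ?_)
    simp only [Nat.cast_zero, sub_zero]
    rw [mul_one_div, ← div_div, div_self two_ne_zero]
  -- For `n > 0` this equals `(n (a (n + 1) - a n) - a n) (1 + 1 / n)`, so the differences of `b`
  -- are polylogarithmic over `n²`.
  have hc : Slow fun n : ℕ => ((n : ℝ) + 1) ^ 2 * (b (n + 1) - b n) := by
    refine ((ha.2.add (ha.1.const_mul (-1))).mul ((Slow.const 1).add hinv)).congr' ?_
    filter_upwards [eventually_gt_atTop 0] with n hn
    have : (n : ℝ) ≠ 0 := by exact_mod_cast hn.ne'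
    have : (n : ℝ) + 1 ≠ 0 := by positivity
    simp only [hb]
    push_cast
    field_simp
    ring
  have hsum : Summable fun n : ℕ => (-1) ^ (n + 1) * (b (n + 1) - b n) := by
    refine Summable.of_norm ((hc.summable_div_sq.norm).congr fun n => ?_)
    have : ((n : ℝ) + 1) ^ 2 ≠ 0 := by positivity
    rw [mul_div_cancel_left₀ _ this]
    simp
  have hlim : Tendsto (fun N : ℕ => (-1 : ℝ) ^ N * b N) atTop (𝓝 0) := by
    have h1 := (ha.1.mul ((Slow.const 1).add hinv)).tendsto_div
    refine squeeze_zero_norm' ?_ (tendsto_norm_zero.comp h1)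
    filter_upwards [eventually_gt_atTop 0] with n hn
    have : (n : ℝ) ≠ 0 := by exact_mod_cast hn.ne'
    have : (n : ℝ) + 1 ≠ 0 := by positivity
    rw [norm_mul, norm_pow, norm_neg, norm_one, one_pow, one_mul]
    apply le_of_eq
    simp only [hb, Function.comp]
    congr 1
    field_simp
  refine ⟨2⁻¹ * (0 + ∑' n : ℕ, (-1) ^ (n + 1) * (b (n + 1) - b n)), ?_⟩
  refine ((hlim.add hsum.hasSum.tendsto_sum_nat).const_mul 2⁻¹).congr fun N => ?_
  rw [← two_mul_sum_alternating b (by simp [hb]), inv_mul_cancel_left₀ two_ne_zero]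

lemma SlowVar.converges_linear {a : ℕ → ℝ} (ha : SlowVar a) (j : ℕ) :
    SeriesConverges fun n => (-1) ^ n * (a n / (2 * (n : ℝ) - j)) := by
  obtain ⟨s, hs⟩ := (ha.mul (slowVar_ratio_linear j)).converges
  refine ⟨s, hs.congr fun N => Finset.sum_congr rfl fun n hn => ?_⟩
  have : (n : ℝ) ≠ 0 := by
    have := (Finset.mem_Icc.1 hn).1
    positivity
  beta_reduce
  rw [mul_div_assoc (a n), div_div_cancel_left' this, ← div_eq_mul_inv]

/-! ### Growth of the nested sums -/

lemma truncT_slowVar (r : ℕ) (k : Fin r → ℕ) (hk : ∀ i, 0 < k i) : SlowVar (truncT r k) := by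
  induction r with
  | zero => exact SlowVar.const 1
  | succ r ih =>
    have h := ih (Fin.init k) fun i => hk _
    obtain ⟨e, he⟩ := Nat.exists_eq_succ_of_ne_zero (hk (Fin.last r)).ne'
    -- One of the `e + 1` factors of the denominator is written as `(l / (2 l - (r + 1))) / l` and
    -- supplies the `1 / l` of a harmonic sum; the other `e` factors are harmless.
    have h2 := ((h.pred.mul (slowVar_ratio_linear (r + 1))).mul
      ((slowVar_inv_linear (r + 1)).pow e)).1.const_mul 2
    have h3 := SlowVar.sum_div h2
    convert h3 using 2 with n
    simp only [truncT]
    refine Finset.sum_congr rfl fun l hl => ?_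
    have : (l : ℝ) ≠ 0 := by
      have := (Finset.mem_Icc.1 hl).1
      positivity
    rw [he, pow_succ, one_div, inv_pow]
    field_simp

lemma altTTerm_converges (r : ℕ) (k : Fin (r + 1) → ℕ) (hk : ∀ i, 0 < k i) :
    SeriesConverges (altTTerm (r + 1) k) := by
  have h := truncT_slowVar r (Fin.init k) fun i => hk _
  obtain ⟨e, he⟩ := Nat.exists_eq_succ_of_ne_zero (hk (Fin.last r)).ne'
  obtain ⟨s, hs⟩ := (((SlowVar.const 2).mul h.pred).mul
    ((slowVar_inv_linear (r + 1)).pow e)).converges_linear (r + 1)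
  refine ⟨s, hs.congr fun N => Finset.sum_congr rfl fun n _ => ?_⟩
  simp only [altTTerm]
  rw [he, pow_succ, one_div, inv_pow]
  field_simp

lemma tSum_ones_succ (r n : ℕ) : tSum (r + 1) (ones (r + 1)) n =
    if Odd (r + 1) then ∑ l ∈ Finset.Icc 1 n, 2 * tSum r (ones r) l / (2 * (l : ℝ) - 1)
    else ∑ l ∈ Finset.Ico 1 n, 2 * tSum r (ones r) l / (2 * (l : ℝ)) := by
  have h : Fin.init (ones (r + 1)) = ones r := rfl
  simp only [tSum, h, ones, pow_one]

lemma sSum_ones_succ (r n : ℕ) : sSum (r + 1) (ones (r + 1)) n =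
    if Odd (r + 1) then ∑ l ∈ Finset.Ico 1 n, 2 * sSum r (ones r) l / (2 * (l : ℝ))
    else ∑ l ∈ Finset.Icc 1 n, 2 * sSum r (ones r) l / (2 * (l : ℝ) - 1) := by
  have h : Fin.init (ones (r + 1)) = ones r := rfl
  simp only [sSum, h, ones, pow_one]

lemma SlowVar.sum_odd {a : ℕ → ℝ} (ha : SlowVar a) :
    SlowVar fun n => ∑ l ∈ Finset.Icc 1 n, 2 * a l / (2 * (l : ℝ) - 1) := by
  convert SlowVar.sum_div ((ha.mul (slowVar_ratio_linear 1)).1.const_mul 2) using 2 with n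
  refine Finset.sum_congr rfl fun l hl => ?_
  have : (l : ℝ) ≠ 0 := by
    have := (Finset.mem_Icc.1 hl).1
    positivity
  push_cast
  field_simp

lemma SlowVar.sum_even {a : ℕ → ℝ} (ha : SlowVar a) :
    SlowVar fun n => ∑ l ∈ Finset.Ico 1 n, 2 * a l / (2 * (l : ℝ)) := by
  refine (SlowVar.sum_div ha.1).pred.congr' ?_
  filter_upwards [eventually_ge_atTop 1] with n hn
  have : Finset.Ico 1 n = Finset.Icc 1 (n - 1) := by
    ext x; simp only [Finset.mem_Ico, Finset.mem_Icc]; omega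
  rw [this]
  refine Finset.sum_congr rfl fun l hl => ?_
  rw [mul_div_mul_left _ _ two_ne_zero]

lemma tSum_slowVar (r : ℕ) : SlowVar (tSum r (ones r)) := by
  induction r with
  | zero => exact SlowVar.const 1
  | succ r ih =>
    by_cases h : Odd (r + 1)
    · exact (show SlowVar fun n => tSum (r + 1) (ones (r + 1)) n by
          simpa only [tSum_ones_succ, if_pos h] using ih.sum_odd)
    · exact (show SlowVar fun n => tSum (r + 1) (ones (r + 1)) n by
          simpa only [tSum_ones_succ, if_neg h] using ih.sum_even)

lemma sSum_slowVar (r : ℕ) : SlowVar (sSum r (ones r)) := by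
  induction r with
  | zero => exact SlowVar.const 1
  | succ r ih =>
    by_cases h : Odd (r + 1)
    · exact (show SlowVar fun n => sSum (r + 1) (ones (r + 1)) n by
          simpa only [sSum_ones_succ, if_pos h] using ih.sum_even)
    · exact (show SlowVar fun n => sSum (r + 1) (ones (r + 1)) n by
          simpa only [sSum_ones_succ, if_neg h] using ih.sum_odd)

lemma SeriesConverges.congr {a b : ℕ → ℝ} (ha : SeriesConverges a) (h : ∀ n, 1 ≤ n → b n = a n) :
    SeriesConverges b := by
  obtain ⟨s, hs⟩ := ha
  exact ⟨s, hs.congr fun N => Finset.sum_congr rfl fun n hn =>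
    (h n (Finset.mem_Icc.1 hn).1).symm⟩

lemma termTTEven_converges (a b : ℕ) : SeriesConverges (termTTEven a b) :=
  ((tSum_slowVar a).mul (tSum_slowVar b)).converges.congr fun n _ => by
    rw [termTTEven, mul_comm]

lemma termTSEven_converges (a b : ℕ) : SeriesConverges (termTSEven a b) :=
  ((tSum_slowVar a).mul (sSum_slowVar b)).converges.congr fun n _ => by
    rw [termTSEven, mul_comm]

lemma termTTOdd_converges (a b : ℕ) : SeriesConverges (termTTOdd a b) :=
  (((tSum_slowVar a).mul (tSum_slowVar b)).converges_linear 1).congr fun n _ => by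
    rw [termTTOdd, mul_comm, Nat.cast_one]

lemma termTSOdd_converges (a b : ℕ) : SeriesConverges (termTSOdd a b) :=
  (((tSum_slowVar a).mul (sSum_slowVar b)).converges_linear 1).congr fun n _ => by
    rw [termTSOdd, mul_comm, Nat.cast_one]

/-! ### Averaging operator, logarithmic moments and integration by parts -/

open unitInterval intervalIntegral PowerSeries

/-- The value at `x` of the averaging operator: `∫_0^1 g (x s) ds`. -/
def averageFun (g : C(I, ℝ)) (x : ℝ) : ℝ :=
  ∫ s in (0 : ℝ)..1, Set.IccExtend zero_le_one g (x * s)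

lemma continuous_averageFun (g : C(I, ℝ)) : Continuous (averageFun g) := by
  unfold averageFun
  refine continuous_parametric_intervalIntegral_of_continuous ?_ continuous_const
  have := g.continuous.Icc_extend' (h := zero_le_one)
  fun_prop

lemma intervalIntegrable_average (g : C(I, ℝ)) (x a b : ℝ) :
    IntervalIntegrable (fun s => Set.IccExtend zero_le_one g (x * s)) MeasureTheory.volume a b := by
  have := g.continuous.Icc_extend' (h := zero_le_one)
  exact Continuous.intervalIntegrable (by fun_prop) _ _

/-- The averaging operator `g ↦ (x ↦ ∫_0^1 g (x s) ds)` on continuous functions on `[0, 1]`. -/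
def average : C(I, ℝ) →ₗ[ℝ] C(I, ℝ) where
  toFun g := ⟨fun x => averageFun g x, (continuous_averageFun g).comp continuous_subtype_val⟩
  map_add' f g := by
    ext x
    simp only [averageFun, ContinuousMap.coe_mk, ContinuousMap.add_apply]
    rw [← integral_add (intervalIntegrable_average f x 0 1) (intervalIntegrable_average g x 0 1)]
    rfl
  map_smul' c g := by
    ext x
    simp only [averageFun, ContinuousMap.coe_mk, ContinuousMap.smul_apply, RingHom.id_apply,
      smul_eq_mul]
    rw [← integral_const_mul]
    rfl

lemma average_apply (g : C(I, ℝ)) (x : I) :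
    average g x = ∫ s in (0 : ℝ)..1, Set.IccExtend zero_le_one g (x * s) := rfl

lemma average_mono {f g : C(I, ℝ)} (h : ∀ x, f x ≤ g x) (x : I) : average f x ≤ average g x := by
  rw [average_apply, average_apply]
  exact integral_mono zero_le_one (intervalIntegrable_average f x 0 1)
    (intervalIntegrable_average g x 0 1) fun s => h _

/-- `IsDeriv f g` says that `g` is the derivative of `f` on `[0, 1]`, where `f` extends to a
function differentiable at every point of `[0, 1]`. -/
def IsDeriv (f g : C(I, ℝ)) : Prop :=
  ∃ F : ℝ → ℝ, (∀ x : I, F x = f x) ∧ ∀ x : I, HasDerivAt F (g x) x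

lemma IsDeriv.const (c : ℝ) : IsDeriv (ContinuousMap.const I c) 0 :=
  ⟨fun _ => c, fun _ => rfl, fun _ => hasDerivAt_const _ _⟩

lemma IsDeriv.one : IsDeriv 1 0 := IsDeriv.const 1

lemma IsDeriv.add {f g f' g' : C(I, ℝ)} (hf : IsDeriv f f') (hg : IsDeriv g g') :
    IsDeriv (f + g) (f' + g') := by
  obtain ⟨F, hF, hF'⟩ := hf
  obtain ⟨G, hG, hG'⟩ := hg
  exact ⟨fun x => F x + G x, fun x => by simp [hF, hG], fun x => (hF' x).add (hG' x)⟩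

lemma IsDeriv.smul {f f' : C(I, ℝ)} (hf : IsDeriv f f') (c : ℝ) : IsDeriv (c • f) (c • f') := by
  obtain ⟨F, hF, hF'⟩ := hf
  exact ⟨fun x => c * F x, fun x => by simp [hF], fun x => (hF' x).const_mul c⟩

lemma IsDeriv.neg {f f' : C(I, ℝ)} (hf : IsDeriv f f') : IsDeriv (-f) (-f') := by
  simpa using hf.smul (-1)

lemma IsDeriv.sub {f g f' g' : C(I, ℝ)} (hf : IsDeriv f f') (hg : IsDeriv g g') :
    IsDeriv (f - g) (f' - g') := by
  simpa [sub_eq_add_neg] using hf.add hg.neg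

lemma IsDeriv.mul {f g f' g' : C(I, ℝ)} (hf : IsDeriv f f') (hg : IsDeriv g g') :
    IsDeriv (f * g) (f' * g + f * g') := by
  obtain ⟨F, hF, hF'⟩ := hf
  obtain ⟨G, hG, hG'⟩ := hg
  exact ⟨fun x => F x * G x, fun x => by simp [hF, hG], fun x => by
    have h := (hF' x).mul (hG' x)
    rw [hF, hG] at h
    exact h⟩

lemma IsDeriv.pow_succ {f f' : C(I, ℝ)} (hf : IsDeriv f f') (n : ℕ) :
    IsDeriv (f ^ (n + 1)) (((n : ℝ) + 1) • (f ^ n * f')) := by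
  induction n with
  | zero => simpa using hf
  | succ n ih =>
    rw [_root_.pow_succ f (n + 1)]
    convert ih.mul hf using 1
    ext x
    simp
    ring

lemma IsDeriv.sum {ι : Type*} (s : Finset ι) {f f' : ι → C(I, ℝ)}
    (h : ∀ i ∈ s, IsDeriv (f i) (f' i)) : IsDeriv (∑ i ∈ s, f i) (∑ i ∈ s, f' i) := by
  classical
  induction s using Finset.induction_on with
  | empty => simpa using IsDeriv.const 0
  | insert i s hi ih =>
    simp only [Finset.sum_insert hi]
    exact (h i (by simp)).add (ih fun j hj => h j (by simp [hj]))

/-- The coordinate function on `[0, 1]`. -/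
def coord : C(I, ℝ) := ⟨fun x => (x : ℝ), continuous_subtype_val⟩

@[simp] lemma coord_apply (x : I) : coord x = x := rfl

lemma isDeriv_coord : IsDeriv coord 1 := ⟨id, fun _ => rfl, fun _ => hasDerivAt_id _⟩

/-- The fundamental theorem of calculus for the averaging operator. -/
lemma average_add_coord_mul {h h' : C(I, ℝ)} (hh : IsDeriv h h') :
    average (h + coord * h') = h := by
  ext x
  rw [average_apply]
  obtain ⟨F, hF, hF'⟩ := isDeriv_coord.mul hh
  rcases eq_or_ne (x : ℝ) 0 with h0 | h0
  · have hx : x = 0 := Subtype.ext h0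
    subst hx
    simp [Set.IccExtend, Set.projIcc]
  · have hg : ∀ x : I, HasDerivAt F ((h + coord * h') x) x := by simpa using hF'
    generalize h + coord * h' = g at hg ⊢
    -- Here `F` extends `t h(t)`, whose derivative is `h + t h'`; the average at `x ≠ 0` is `1 / x`
    -- times this integral.
    have hint : ∫ s in (0 : ℝ)..x, Set.IccExtend zero_le_one g s = F x - F 0 := by
      refine integral_eq_sub_of_hasDerivAt (fun s hs => ?_) ?_
      · rw [Set.uIcc_of_le x.2.1] at hs
        have hs' : s ∈ I := ⟨hs.1, hs.2.trans x.2.2⟩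
        rw [Set.IccExtend_of_mem _ _ hs']
        exact hg ⟨s, hs'⟩
      · exact (g.continuous.Icc_extend' (h := zero_le_one)).intervalIntegrable _ _
    have h1 := intervalIntegral.mul_integral_comp_mul_left (a := 0) (b := 1)
      (f := Set.IccExtend zero_le_one g) (c := (x : ℝ))
    rw [mul_zero, mul_one, hint, hF x, show F 0 = 0 by simpa using hF 0, sub_zero] at h1
    exact mul_left_cancel₀ h0 h1

lemma iterate_average_mono (n : ℕ) {f g : C(I, ℝ)} (h : ∀ x, f x ≤ g x) (x : I) :
    (average ^ n) f x ≤ (average ^ n) g x := by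
  induction n generalizing f g with
  | zero => exact h x
  | succ n ih =>
    rw [pow_succ, Module.End.mul_apply, Module.End.mul_apply]
    exact ih (average_mono h)

/-- The generating series of the moments `g ↦ ∫_0^1 g(t) (-log t)^q / q! dt`, realised by iterated
averages. -/
def moments : C(I, ℝ) →ₗ[ℝ] ℝ⟦X⟧ where
  toFun g := PowerSeries.mk fun q => (average ^ (q + 1)) g 1
  map_add' f g := by ext q; simp
  map_smul' c g := by ext q; simp

lemma coeff_moments (g : C(I, ℝ)) (q : ℕ) : coeff q (moments g) = (average ^ (q + 1)) g 1 := by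
  simp [moments]

/-- The innermost average turns `(t h)'` back into `h`, so each coefficient loses one average and
its degree shifts by one. In degree `0` no average is left, only the value at `1`. All integrations
by parts below are instances of this. -/
lemma moments_add_coord_mul {h h' : C(I, ℝ)} (hh : IsDeriv h h') :
    moments (h + coord * h') = X * moments h + C (h 1) := by
  ext q
  rw [coeff_moments, pow_succ, Module.End.mul_apply, average_add_coord_mul hh]
  cases q with
  | zero => simp
  | succ q => simp [coeff_succ_X_mul, coeff_moments]

lemma coeff_moments_mono {f g : C(I, ℝ)} (h : ∀ x, f x ≤ g x) (q : ℕ) :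
    coeff q (moments f) ≤ coeff q (moments g) := by
  rw [coeff_moments, coeff_moments]
  exact iterate_average_mono _ h 1

lemma abs_coeff_moments_le {f g : C(I, ℝ)} (h : ∀ x, |f x| ≤ g x) (q : ℕ) :
    |coeff q (moments f)| ≤ coeff q (moments g) := by
  rw [abs_le]
  constructor
  · rw [neg_le, ← map_neg, ← map_neg]
    exact coeff_moments_mono (fun x => (neg_le_abs _).trans (h x)) q
  · exact coeff_moments_mono (fun x => (le_abs_self _).trans (h x)) q

/-- The expansion of `1 / (a - X)`. -/
def geom (a : ℝ) : ℝ⟦X⟧ := PowerSeries.mk fun q => 1 / a ^ (q + 1)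

lemma sub_X_mul_geom {a : ℝ} (ha : a ≠ 0) : (C a - X) * geom a = 1 := by
  ext q
  cases q with
  | zero => simp [geom, sub_mul, ha]
  | succ q =>
    simp [geom, sub_mul, coeff_succ_X_mul, coeff_one]
    field_simp
    ring

lemma eq_geom_mul {a : ℝ} (ha : a ≠ 0) {f g : ℝ⟦X⟧} (h : (C a - X) * f = g) : f = geom a * g := by
  rw [← h, ← mul_assoc, mul_comm (geom a), sub_X_mul_geom ha, one_mul]

/-- Integration by parts with `h = t^n`, for which `(t h)' = (n + 1) t^n`. -/
lemma moments_coord_pow (n : ℕ) : moments (coord ^ n) = geom (n + 1) := by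
  have hn : (n : ℝ) + 1 ≠ 0 := by positivity
  have h : (C ((n : ℝ) + 1) - X) * moments (coord ^ n) = 1 := by
    rw [sub_mul, sub_eq_iff_eq_add, ← smul_eq_C_mul, ← map_smul]
    have h1 : ((n : ℝ) + 1) • coord ^ n = coord ^ n + coord * ((n : ℝ) • coord ^ (n - 1)) := by
      ext x
      cases n with
      | zero => simp
      | succ n => simp; ring
    rw [h1, moments_add_coord_mul]
    · simp [add_comm]
    · cases n with
      | zero => simpa using IsDeriv.one
      | succ n => simpa using isDeriv_coord.pow_succ n
  simpa using eq_geom_mul hn h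

lemma coeff_moments_coord_pow (n q : ℕ) :
    coeff q (moments (coord ^ n)) = 1 / ((n : ℝ) + 1) ^ (q + 1) := by
  rw [moments_coord_pow, geom, coeff_mk]

/-! ### The functions entering the iterated integrals -/

/-- `t ↦ 2 / (1 + t²)` on `[0, 1]`. -/
def angleWeight : C(I, ℝ) :=
  ⟨fun t => 2 / (1 + (t : ℝ) ^ 2), by
    refine Continuous.div (by fun_prop) (by fun_prop) fun t => by positivity⟩

/-- `t ↦ π / 2 - 2 arctan t` on `[0, 1]`. -/
def angle : C(I, ℝ) := ⟨fun t => Real.pi / 2 - 2 * Real.arctan t, by fun_prop⟩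

lemma isDeriv_angle : IsDeriv angle (-angleWeight) := by
  refine ⟨fun t => Real.pi / 2 - 2 * Real.arctan t, fun _ => rfl, fun t => ?_⟩
  refine (((Real.hasDerivAt_arctan (t : ℝ)).const_mul 2).const_sub (Real.pi / 2)).congr_deriv ?_
  simp [angleWeight]
  ring

lemma angle_one : angle 1 = 0 := by
  simp [angle, Real.arctan_one]
  ring

lemma angleWeight_mul : angleWeight * (1 + coord ^ 2) = 2 := by
  ext t
  have : 1 + (t : ℝ) ^ 2 ≠ 0 := by positivity
  have h2 : (2 : C(I, ℝ)) t = 2 := rfl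
  simp [angleWeight, this, h2]

/-- The divided powers `(π / 2 - 2 arctan t)^j / j!`. -/
def anglePow (j : ℕ) : C(I, ℝ) := (1 / (j.factorial : ℝ)) • angle ^ j

@[simp] lemma anglePow_zero : anglePow 0 = 1 := by simp [anglePow]

lemma isDeriv_anglePow_succ (j : ℕ) :
    IsDeriv (anglePow (j + 1)) (-(angleWeight * anglePow j)) := by
  convert (isDeriv_angle.pow_succ j).smul (1 / ((j + 1).factorial : ℝ)) using 1
  · rfl
  ext t
  have h1 : (j.factorial : ℝ) ≠ 0 := by positivity
  have h2 : (j : ℝ) + 1 ≠ 0 := by positivity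
  simp [anglePow, Nat.factorial_succ]
  field_simp

lemma anglePow_succ_one (j : ℕ) : anglePow (j + 1) 1 = 0 := by
  simp [anglePow, angle_one]

/-- Moment series of `t^N (π / 2 - 2 arctan t)^j / j!`. -/
def angleMoment (j N : ℕ) : ℝ⟦X⟧ := moments (coord ^ N * anglePow j)

/-- Moment series of `t^N (π / 2 - 2 arctan t)^j / j! · 2 / (1 + t²)`. -/
def weightedAngleMoment (j N : ℕ) : ℝ⟦X⟧ := moments (coord ^ N * anglePow j * angleWeight)

lemma weightedAngleMoment_add (j N : ℕ) :
    weightedAngleMoment j N + weightedAngleMoment j (N + 2) = 2 * angleMoment j N := by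
  rw [weightedAngleMoment, weightedAngleMoment, angleMoment, ← map_add, two_mul, ← map_add]
  congr 1
  linear_combination (coord ^ N * anglePow j) * angleWeight_mul

lemma angleMoment_zero (N : ℕ) : (C ((N : ℝ) + 1) - X) * angleMoment 0 N = 1 := by
  rw [angleMoment, anglePow_zero, mul_one, moments_coord_pow, sub_X_mul_geom (by positivity)]

/-- Integration by parts with `h = t^N · angle^(j+1) / (j+1)!`. There is no boundary term because
`angle` vanishes at `1`. -/
lemma angleMoment_succ (j N : ℕ) :
    (C ((N : ℝ) + 1) - X) * angleMoment (j + 1) N = weightedAngleMoment j (N + 1) := by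
  have hd : IsDeriv (coord ^ N * anglePow (j + 1))
      (((N : ℝ) • coord ^ (N - 1)) * anglePow (j + 1) +
        coord ^ N * -(angleWeight * anglePow j)) := by
    refine IsDeriv.mul ?_ (isDeriv_anglePow_succ j)
    cases N with
    | zero => simpa using IsDeriv.one
    | succ n => simpa using isDeriv_coord.pow_succ n
  have h := moments_add_coord_mul hd
  have h1 : coord ^ N * anglePow (j + 1) + coord * (((N : ℝ) • coord ^ (N - 1)) * anglePow (j + 1) +
        coord ^ N * -(angleWeight * anglePow j)) =
      ((N : ℝ) + 1) • (coord ^ N * anglePow (j + 1)) -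
        coord ^ (N + 1) * anglePow j * angleWeight := by
    ext t
    cases N with
    | zero => simp; ring
    | succ n => simp; ring
  rw [h1, map_sub, map_smul, smul_eq_C_mul] at h
  have h2 : (coord ^ N * anglePow (j + 1)) 1 = 0 := by simp [anglePow_succ_one]
  rw [h2, map_zero, add_zero] at h
  rw [angleMoment, weightedAngleMoment, sub_mul, ← h]
  ring

/-! ### Generating series of the truncated sums -/

/-- `∑_k truncT r k n X^(|k| - r)`, over all indices `k` of depth `r`. -/
def truncSeries : ℕ → ℕ → ℝ⟦X⟧
  | 0, _ => 1
  | r + 1, n => ∑ l ∈ Finset.Icc 1 n,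
      2 * truncSeries r (l - 1) * geom (2 * (l : ℝ) - ((r + 1 : ℕ) : ℝ))

/-- The increment in `n` of `truncSeries r n`. -/
def truncStep : ℕ → ℕ → ℝ⟦X⟧
  | 0, _ => 0
  | r + 1, n => 2 * truncSeries r (n - 1) * geom (2 * (n : ℝ) - ((r + 1 : ℕ) : ℝ))

lemma truncSeries_succ (r n : ℕ) :
    truncSeries r (n + 1) = truncSeries r n + truncStep r (n + 1) := by
  cases r with
  | zero => simp [truncSeries, truncStep]
  | succ r => rw [truncSeries, Finset.sum_Icc_succ_top (by omega), ← truncSeries, truncStep]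

/-- This vanishing makes the truncated subtractions `2 * n - i` and the nonpositive denominators
harmless: both occur only next to a zero factor. -/
lemma truncSeries_eq_zero {r n : ℕ} (h : n < r) : truncSeries r n = 0 := by
  induction r generalizing n with
  | zero => omega
  | succ r ih =>
    rw [truncSeries]
    refine Finset.sum_eq_zero fun l hl => ?_
    have := Finset.mem_Icc.1 hl
    rw [ih (by omega), mul_zero, zero_mul]

/-- The part of the telescoping invariant which still carries `d` iterated integrations, preceded
by a truncated sum of depth `i`. -/
def mixedTerm (i d n : ℕ) : ℝ⟦X⟧ := truncStep i (n + 1) * weightedAngleMoment d (2 * n + 2 - i)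

/-- The factor `geom` in `truncStep` inverts the linear factor produced by integration by parts, so
one power of the angle is traded for one more level of summation. -/
lemma two_mul_truncSeries_mul_succ (i d n : ℕ) :
    2 * (truncSeries i n * angleMoment (d + 1) (2 * n - i)) = mixedTerm (i + 1) d n := by
  rcases lt_or_ge n i with h | h
  · simp [mixedTerm, truncStep, truncSeries_eq_zero h]
  · obtain ⟨e, rfl⟩ := Nat.exists_eq_add_of_le h
    have h1 : 2 * (i + e) + 2 - (i + 1) = 2 * (i + e) - i + 1 := by omega
    have h2 : (2 * ((i + e + 1 : ℕ) : ℝ) - ((i + 1 : ℕ) : ℝ)) =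
        ((2 * (i + e) - i : ℕ) : ℝ) + 1 := by
      rw [Nat.cast_sub (by omega)]
      push_cast
      ring
    have hne : ((2 * (i + e) - i : ℕ) : ℝ) + 1 ≠ 0 := by positivity
    rw [mixedTerm, h1, ← angleMoment_succ, truncStep, h2, Nat.add_sub_cancel]
    linear_combination (-2 * truncSeries i (i + e) * angleMoment (d + 1) (2 * (i + e) - i)) *
      sub_X_mul_geom hne

lemma two_mul_truncSeries_mul_zero (i n : ℕ) :
    2 * (truncSeries i n * angleMoment 0 (2 * n - i)) = truncStep (i + 1) (n + 1) := by
  rcases lt_or_ge n i with h | h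
  · simp [truncStep, truncSeries_eq_zero h]
  · obtain ⟨e, rfl⟩ := Nat.exists_eq_add_of_le h
    have h2 : (2 * ((i + e + 1 : ℕ) : ℝ) - ((i + 1 : ℕ) : ℝ)) =
        ((2 * (i + e) - i : ℕ) : ℝ) + 1 := by
      rw [Nat.cast_sub (by omega)]
      push_cast
      ring
    have hne : ((2 * (i + e) - i : ℕ) : ℝ) + 1 ≠ 0 := by positivity
    rw [truncStep, h2, Nat.add_sub_cancel, eq_geom_mul hne (angleMoment_zero _), mul_one, mul_assoc]

/-- The weights `t^N` and `t^(N+2)` add up to `t^N (1 + t²)`, which cancels the denominator of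
`angleWeight`; what remains is the increment of the truncated sum. -/
lemma truncSeries_mul_add (i d n : ℕ) :
    truncSeries i (n + 1) * weightedAngleMoment d (2 * (n + 1) - i) +
        truncSeries i n * weightedAngleMoment d (2 * n - i) =
      mixedTerm i d n + 2 * (truncSeries i n * angleMoment d (2 * n - i)) := by
  have h : truncSeries i n * (weightedAngleMoment d (2 * n - i) +
      weightedAngleMoment d (2 * (n + 1) - i)) =
      truncSeries i n * (2 * angleMoment d (2 * n - i)) := by
    rcases lt_or_ge n i with h | h
    · simp [truncSeries_eq_zero h]
    · rw [← weightedAngleMoment_add, show 2 * (n + 1) - i = 2 * n - i + 2 by omega]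
  rw [truncSeries_succ, mixedTerm, show 2 * n + 2 = 2 * (n + 1) by ring]
  linear_combination h

/-- The boundary terms of the telescoping invariant. -/
def boundary (r n : ℕ) : ℝ⟦X⟧ := ∑ i ∈ Finset.range (r + 1),
  (-1) ^ (n + i) * (truncSeries i n * weightedAngleMoment (r - i) (2 * n - i))

lemma boundary_zero (r : ℕ) : boundary r 0 = weightedAngleMoment r 0 := by
  rw [boundary, Finset.sum_range_succ', Finset.sum_eq_zero]
  · simp [truncSeries]
  · intro i _
    rw [truncSeries_eq_zero (Nat.succ_pos i)]
    simp

/-- By `truncSeries_mul_add`, passing from `n` to `n + 1` adds two terms for each depth `i`. By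
`two_mul_truncSeries_mul_succ` the second cancels the first one of depth `i + 1`, so only the second
term at `i = r`, where no angle is left, survives. -/
lemma boundary_succ (r n : ℕ) :
    boundary r (n + 1) = boundary r n + (-1) ^ (n + 1 + r) * truncStep (r + 1) (n + 1) := by
  have key : ∀ i ∈ Finset.range (r + 1),
      (-1) ^ (n + 1 + i) * (truncSeries i (n + 1) * weightedAngleMoment (r - i) (2 * (n + 1) - i)) =
      (-1) ^ (n + i) * (truncSeries i n * weightedAngleMoment (r - i) (2 * n - i)) +
        ((-1) ^ (n + 1 + i) * mixedTerm i (r - i) n -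
          (-1) ^ (n + 1 + (i + 1)) * (2 * (truncSeries i n * angleMoment (r - i) (2 * n - i)))) := by
    intro i _
    rw [eq_sub_of_add_eq (truncSeries_mul_add i (r - i) n)]
    ring
  have tele : ∀ s ≤ r, ∑ i ∈ Finset.range s,
      ((-1) ^ (n + 1 + i) * mixedTerm i (r - i) n -
          (-1) ^ (n + 1 + (i + 1)) * (2 * (truncSeries i n * angleMoment (r - i) (2 * n - i)))) =
      - ((-1) ^ (n + 1 + s) * mixedTerm s (r - s) n) := by
    intro s
    induction s with
    | zero => simp [mixedTerm, truncStep]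
    | succ s ih =>
      intro hs
      rw [Finset.sum_range_succ, ih (by omega), show r - s = r - (s + 1) + 1 by omega,
        two_mul_truncSeries_mul_succ]
      ring
  rw [boundary, Finset.sum_congr rfl key, Finset.sum_add_distrib, ← boundary,
    Finset.sum_range_succ, tele r le_rfl, Nat.sub_self, two_mul_truncSeries_mul_zero]
  ring

/-- The connected-sum identity relating alternating nested sums to iterated integrals. -/
lemma sum_truncStep (r n : ℕ) :
    ∑ l ∈ Finset.Icc 1 n, (-1) ^ (l + r) * truncStep (r + 1) l =
      boundary r n - weightedAngleMoment r 0 := by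
  induction n with
  | zero => simp [boundary_zero]
  | succ n ih => rw [Finset.sum_Icc_succ_top (by omega), ih, boundary_succ]; ring

/-! ### Sums over indices of given weight and depth -/

lemma mem_indexSet {w r : ℕ} {k : Fin r → ℕ} :
    k ∈ indexSet w r ↔ ∑ i, k i = w ∧ ∀ i, 0 < k i := by
  simp [indexSet, Finset.Nat.mem_antidiagonalTuple]

/-- Detaching the last exponent splits the excess `q` of weight over depth into two parts, which
matches the Cauchy product with `geom`. -/
lemma sum_indexSet_succ (r q : ℕ) (f : (Fin r → ℕ) → ℕ → ℝ) :
    ∑ k ∈ indexSet (r + 1 + q) (r + 1), f (Fin.init k) (k (Fin.last r)) =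
      ∑ ab ∈ Finset.HasAntidiagonal.antidiagonal q, ∑ k ∈ indexSet (r + ab.1) r, f k (ab.2 + 1) := by
  rw [Finset.sum_sigma']
  symm
  refine Finset.sum_bij' (fun x _ => (Fin.snoc x.2 (x.1.2 + 1) : Fin (r + 1) → ℕ))
    (fun k _ => ⟨(∑ i, Fin.init k i - r, k (Fin.last r) - 1), Fin.init k⟩) ?_ ?_ ?_ ?_ ?_
  · rintro ⟨⟨a, b⟩, k⟩ h
    simp only [Finset.mem_sigma, Finset.HasAntidiagonal.mem_antidiagonal, mem_indexSet] at h ⊢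
    refine ⟨?_, fun i => ?_⟩
    · rw [Fin.sum_univ_castSucc]
      simp only [Fin.snoc_castSucc, Fin.snoc_last]
      omega
    · refine Fin.lastCases ?_ (fun j => ?_) i
      · simp
      · simpa using h.2.2 j
  · intro k h
    simp only [Finset.mem_sigma, Finset.HasAntidiagonal.mem_antidiagonal, mem_indexSet] at h ⊢
    obtain ⟨h1, h2⟩ := h
    have h3 : r ≤ ∑ i, Fin.init k i := by
      calc r = ∑ _i : Fin r, 1 := by simp
        _ ≤ _ := Finset.sum_le_sum fun i _ => h2 i.castSucc
    have h4 : ∑ i, Fin.init k i + k (Fin.last r) = r + 1 + q := by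
      rw [← h1, Fin.sum_univ_castSucc]; rfl
    have h5 := h2 (Fin.last r)
    exact ⟨by omega, by omega, fun i => h2 i.castSucc⟩
  · rintro ⟨⟨a, b⟩, k⟩ h
    simp only [Finset.mem_sigma, Finset.HasAntidiagonal.mem_antidiagonal, mem_indexSet] at h
    simp only [Fin.init_snoc, Fin.snoc_last, h.2.1, Nat.add_sub_cancel_left, Nat.add_sub_cancel]
  · intro k h
    have h5 := (mem_indexSet.1 h).2 (Fin.last r)
    simp only
    rw [Nat.sub_add_cancel h5, Fin.snoc_init_self]
  · rintro ⟨⟨a, b⟩, k⟩ h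
    simp

lemma coeff_two_mul (f : ℝ⟦X⟧) (q : ℕ) : coeff q (2 * f) = 2 * coeff q f := by
  rw [← map_ofNat C 2, coeff_C_mul]

lemma coeff_truncStep_of_truncSeries (r : ℕ)
    (h : ∀ q n, coeff q (truncSeries r n) = ∑ k ∈ indexSet (r + q) r, truncT r k n) (q n : ℕ) :
    coeff q (truncStep (r + 1) n) = ∑ k ∈ indexSet (r + 1 + q) (r + 1),
      2 * truncT r (Fin.init k) (n - 1) / (2 * (n : ℝ) - ((r + 1 : ℕ) : ℝ)) ^ k (Fin.last r) := by
  rw [sum_indexSet_succ r q fun k e =>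
    2 * truncT r k (n - 1) / (2 * (n : ℝ) - ((r + 1 : ℕ) : ℝ)) ^ e]
  rw [truncStep, mul_assoc, coeff_two_mul, coeff_mul, Finset.mul_sum]
  refine Finset.sum_congr rfl fun ab _ => ?_
  rw [h, geom, coeff_mk, Finset.sum_mul, Finset.mul_sum]
  refine Finset.sum_congr rfl fun k _ => ?_
  ring

lemma coeff_truncSeries (r q n : ℕ) :
    coeff q (truncSeries r n) = ∑ k ∈ indexSet (r + q) r, truncT r k n := by
  induction r generalizing q n with
  | zero =>
    rcases Nat.eq_zero_or_pos q with rfl | hq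
    · simp [truncSeries, indexSet, truncT]
    · have h : indexSet (0 + q) 0 = ∅ := by
        ext k
        simp [mem_indexSet, hq.ne]
      rw [h]
      simp [truncSeries, coeff_one, hq.ne']
  | succ r ih =>
    have h : ∀ l, 2 * truncSeries r (l - 1) * geom (2 * (l : ℝ) - ((r + 1 : ℕ) : ℝ)) =
      truncStep (r + 1) l := fun l => rfl
    simp only [truncSeries, h, map_sum, truncT, coeff_truncStep_of_truncSeries r ih]
    rw [Finset.sum_comm]

lemma coeff_truncStep (r q n : ℕ) :
    (-1) ^ n * coeff q (truncStep (r + 1) n) =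
      ∑ k ∈ indexSet (r + 1 + q) (r + 1), altTTerm (r + 1) k n := by
  rw [coeff_truncStep_of_truncSeries r (coeff_truncSeries r), Finset.mul_sum]
  refine Finset.sum_congr rfl fun k _ => ?_
  simp only [altTTerm]
  ring

lemma coeff_truncSeries_slow (r q : ℕ) : Slow fun n => coeff q (truncSeries r n) := by
  simp only [coeff_truncSeries]
  exact Slow.sum _ fun k hk => (truncT_slowVar r k (mem_indexSet.1 hk).2).1

/-! ### Passing to the limit -/

lemma abs_coeff_moments_coord_pow_mul_le (f : C(I, ℝ)) (q N : ℕ) :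
    |coeff q (moments (coord ^ N * f))| ≤ ‖f‖ / ((N : ℝ) + 1) := by
  have h1 : ∀ x, |(coord ^ N * f) x| ≤ (‖f‖ • coord ^ N) x := by
    intro x
    simp only [ContinuousMap.mul_apply, ContinuousMap.pow_apply, coord_apply, abs_mul,
      ContinuousMap.smul_apply, smul_eq_mul]
    rw [abs_of_nonneg (pow_nonneg x.2.1 N), mul_comm]
    exact mul_le_mul_of_nonneg_right (f.norm_coe_le_norm x) (pow_nonneg x.2.1 N)
  refine (abs_coeff_moments_le h1 q).trans ?_
  rw [map_smul, PowerSeries.coeff_smul, coeff_moments_coord_pow, smul_eq_mul, mul_one_div]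
  have h2 : (1 : ℝ) ≤ N + 1 := by linarith [(N.cast_nonneg : (0 : ℝ) ≤ N)]
  gcongr
  exact le_self_pow₀ h2 (by omega)

lemma Slow.tendsto_mul_zero {a b : ℕ → ℝ} (ha : Slow a) (C : ℝ)
    (hb : ∀ᶠ n in atTop, |b n| ≤ C / ((n : ℝ) + 1)) :
    Tendsto (fun n => a n * b n) atTop (𝓝 0) := by
  have h := (tendsto_norm_zero.comp ha.tendsto_div).mul_const C
  rw [zero_mul] at h
  refine squeeze_zero_norm' ?_ h
  filter_upwards [hb] with n hn
  have h1 : (0 : ℝ) < n + 1 := by positivity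
  rw [Function.comp, norm_mul, norm_div, Real.norm_eq_abs, Real.norm_eq_abs, Real.norm_eq_abs,
    abs_of_pos h1, div_mul_eq_mul_div, mul_div_assoc]
  exact mul_le_mul_of_nonneg_left hn (abs_nonneg _)

/-- Each coefficient is a finite sum of products of a polylogarithmic factor and a moment against
`t^(2n-i)`, which is `O(1 / n)`. -/
lemma tendsto_coeff_boundary (r q : ℕ) :
    Tendsto (fun n => coeff q (boundary r n)) atTop (𝓝 0) := by
  simp only [boundary, map_sum]
  rw [← Finset.sum_const_zero (s := Finset.range (r + 1)) (ι := ℕ)]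
  refine tendsto_finsetSum _ fun i _ => ?_
  have h1 : Tendsto (fun n => coeff q (truncSeries i n * weightedAngleMoment (r - i) (2 * n - i)))
      atTop (𝓝 0) := by
    simp only [coeff_mul]
    rw [← Finset.sum_const_zero (s := Finset.HasAntidiagonal.antidiagonal q) (ι := ℕ × ℕ)]
    refine tendsto_finsetSum _ fun ab _ => ?_
    refine (coeff_truncSeries_slow i ab.1).tendsto_mul_zero
      ‖anglePow (r - i) * angleWeight‖ ?_
    filter_upwards [eventually_ge_atTop i] with n hn
    rw [weightedAngleMoment, mul_assoc]
    refine (abs_coeff_moments_coord_pow_mul_le _ _ _).trans ?_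
    gcongr
    omega
  refine squeeze_zero_norm (fun n => le_of_eq ?_) (tendsto_norm_zero.comp h1)
  have : ((-1) ^ (n + i) : ℝ⟦X⟧) = C ((-1) ^ (n + i)) := by simp
  rw [this, coeff_C_mul, norm_mul, norm_pow, norm_neg, norm_one, one_pow, one_mul,
    Function.comp]

lemma series_eq {a : ℕ → ℝ} {s : ℝ}
    (h : Tendsto (fun N : ℕ => ∑ n ∈ Finset.Icc 1 N, a n) atTop (𝓝 s)) : series a = s :=
  h.limUnder_eq

lemma SeriesConverges.tendsto {a : ℕ → ℝ} (h : SeriesConverges a) :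
    Tendsto (fun N : ℕ => ∑ n ∈ Finset.Icc 1 N, a n) atTop (𝓝 (series a)) := by
  obtain ⟨s, hs⟩ := h
  rwa [series_eq hs]

/-- `W` as a moment of a power of an arctangent. -/
lemma W_eq_coeff (r q : ℕ) :
    W (r + 1 + q) (r + 1) = (-1) ^ (r + 1) * coeff q (moments (anglePow r * angleWeight)) := by
  have h1 : Tendsto (fun N => ∑ k ∈ indexSet (r + 1 + q) (r + 1),
      ∑ n ∈ Finset.Icc 1 N, altTTerm (r + 1) k n) atTop (𝓝 (W (r + 1 + q) (r + 1))) :=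
    tendsto_finsetSum _ fun k hk => (altTTerm_converges r k (mem_indexSet.1 hk).2).tendsto
  have h2 : ∀ N, ∑ k ∈ indexSet (r + 1 + q) (r + 1),
      ∑ n ∈ Finset.Icc 1 N, altTTerm (r + 1) k n =
      (-1) ^ r * coeff q (boundary r N - weightedAngleMoment r 0) := by
    intro N
    rw [Finset.sum_comm, ← sum_truncStep, map_sum, Finset.mul_sum]
    refine Finset.sum_congr rfl fun n _ => ?_
    have : ((-1) ^ (n + r) : ℝ⟦X⟧) = C ((-1) ^ (n + r)) := by simp
    rw [← coeff_truncStep, this, coeff_C_mul, ← mul_assoc, ← pow_add,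
      show r + (n + r) = 2 * r + n by ring, pow_add, pow_mul]
    simp
  simp only [h2, map_sub] at h1
  have h3 := ((tendsto_coeff_boundary r q).sub_const
    (coeff q (weightedAngleMoment r 0))).const_mul ((-1) ^ r)
  rw [tendsto_nhds_unique h1 h3, weightedAngleMoment, pow_zero, one_mul]
  ring

/-! ### A second order recursion -/

/-- The solution of `s (k + 2) = ε s k + 2 X s (k + 1) / (k + 1)` with `s 0 = a`, `s 1 = b`. -/
def recSeq (ε : ℝ) (a b : ℝ⟦X⟧) : ℕ → ℝ⟦X⟧
  | 0 => a
  | 1 => b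
  | k + 2 => C ε * recSeq ε a b k + C (2 / ((k : ℝ) + 1)) * (X * recSeq ε a b (k + 1))

lemma coeff_zero_recSeq (ε : ℝ) (a b : ℝ⟦X⟧) (k : ℕ) :
    coeff 0 (recSeq ε a b (k + 2)) = ε * coeff 0 (recSeq ε a b k) := by
  simp [recSeq]

lemma coeff_succ_recSeq (ε : ℝ) (a b : ℝ⟦X⟧) (r k : ℕ) :
    coeff (r + 1) (recSeq ε a b (k + 2)) = ε * coeff (r + 1) (recSeq ε a b k) +
      2 / ((k : ℝ) + 1) * coeff r (recSeq ε a b (k + 1)) := by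
  simp only [recSeq, map_add, coeff_C_mul, coeff_succ_X_mul]

/-- Unrolling the inequality bounds `f` by its two initial values plus a harmonic sum of `|g|`. -/
lemma Slow.of_recursion {f g : ℕ → ℝ} (hg : Slow g)
    (h : ∀ k, |f (k + 2)| ≤ |f k| + |g (k + 1) / ((k + 1 : ℕ) : ℝ)|) : Slow f := by
  have hg' : Slow fun n => |g n| := hg.mono fun n => by simp
  refine ((Slow.const (|f 0| + |f 1|)).add hg'.sum_div).mono fun n => ?_
  refine le_trans ?_ (le_abs_self _)
  have key : ∀ n, |f n| ≤ |f 0| + |f 1| + ∑ l ∈ Finset.Icc 1 n, |g l| / l ∧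
      |f (n + 1)| ≤ |f 0| + |f 1| + ∑ l ∈ Finset.Icc 1 (n + 1), |g l| / l := by
    intro n
    induction n with
    | zero =>
      have h1 : 0 ≤ |g 1| := abs_nonneg _
      have h2 : 0 ≤ |f 1| := abs_nonneg _
      have h3 : 0 ≤ |f 0| := abs_nonneg _
      simp
      linarith
    | succ n ih =>
      refine ⟨ih.2, (h n).trans ?_⟩
      rw [Finset.sum_Icc_succ_top (by omega), Finset.sum_Icc_succ_top (by omega), abs_div,
        Nat.abs_cast]
      have : 0 ≤ |g (n + 1 + 1)| / ((n + 1 + 1 : ℕ) : ℝ) := by positivity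
      linarith [ih.1]
  exact (key n).1

lemma coeff_recSeq_slow {ε : ℝ} (hε : |ε| ≤ 1) (a b : ℝ⟦X⟧) (r : ℕ) :
    Slow fun k => coeff r (recSeq ε a b k) := by
  induction r with
  | zero =>
    refine Slow.of_recursion (Slow.const 0) fun k => ?_
    rw [coeff_zero_recSeq, abs_mul]
    simpa using mul_le_of_le_one_left (abs_nonneg _) hε
  | succ r ih =>
    refine Slow.of_recursion (ih.const_mul 2) fun k => ?_
    rw [coeff_succ_recSeq]
    refine (abs_add_le _ _).trans (add_le_add ?_ (le_of_eq ?_))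
    · rw [abs_mul]
      exact mul_le_of_le_one_left (abs_nonneg _) hε
    · push_cast
      congr 1
      ring

/-! ### Coefficients of the recursion as `T`- and `S`-harmonic sums -/

lemma tSum_odd_succ {r : ℕ} (hr : Even r) (n : ℕ) : tSum (r + 1) (ones (r + 1)) (n + 1) =
    tSum (r + 1) (ones (r + 1)) n + 2 / (2 * (n : ℝ) + 1) * tSum r (ones r) (n + 1) := by
  rw [tSum_ones_succ, tSum_ones_succ, if_pos hr.add_one, if_pos hr.add_one,
    Finset.sum_Icc_succ_top (by omega)]
  push_cast
  rw [show 2 * ((n : ℝ) + 1) - 1 = 2 * n + 1 by ring]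
  ring

lemma tSum_even_succ {r : ℕ} (hr : Odd r) (n : ℕ) : tSum (r + 1) (ones (r + 1)) (n + 2) =
    tSum (r + 1) (ones (r + 1)) (n + 1) +
      2 / (2 * (n : ℝ) + 1 + 1) * tSum r (ones r) (n + 1) := by
  have h : ¬ Odd (r + 1) := Nat.not_odd_iff_even.2 hr.add_one
  rw [tSum_ones_succ, tSum_ones_succ, if_neg h, if_neg h, Finset.sum_Ico_succ_top (by omega)]
  push_cast
  rw [show 2 * ((n : ℝ) + 1) = 2 * n + 1 + 1 by ring]
  ring

lemma sSum_even_succ {r : ℕ} (hr : Odd r) (n : ℕ) : sSum (r + 1) (ones (r + 1)) (n + 1) =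
    sSum (r + 1) (ones (r + 1)) n + 2 / (2 * (n : ℝ) + 1) * sSum r (ones r) (n + 1) := by
  have h : ¬ Odd (r + 1) := Nat.not_odd_iff_even.2 hr.add_one
  rw [sSum_ones_succ, sSum_ones_succ, if_neg h, if_neg h, Finset.sum_Icc_succ_top (by omega)]
  push_cast
  rw [show 2 * ((n : ℝ) + 1) - 1 = 2 * n + 1 by ring]
  ring

lemma sSum_odd_succ {r : ℕ} (hr : Even r) (n : ℕ) : sSum (r + 1) (ones (r + 1)) (n + 2) =
    sSum (r + 1) (ones (r + 1)) (n + 1) +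
      2 / (2 * (n : ℝ) + 1 + 1) * sSum r (ones r) (n + 1) := by
  rw [sSum_ones_succ, sSum_ones_succ, if_pos hr.add_one, if_pos hr.add_one,
    Finset.sum_Ico_succ_top (by omega)]
  push_cast
  rw [show 2 * ((n : ℝ) + 1) = 2 * n + 1 + 1 by ring]
  ring

/-- Each factor `X` comes with a change of parity of the index, so a coefficient of degree `r`
survives for one parity only. The denominators `2l - 1` and `2l` then alternate, and the recursion
is that of `tSum`. The shifted index `n + 1` at odd places reflects the bounds `≤ n` and `< n` in
the two parities. -/
lemma coeff_recSeq_zero_one {ε : ℝ} (hε : ε * ε = 1) (n : ℕ) : ∀ r,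
    coeff r (recSeq ε 0 1 (2 * n)) =
        (if Odd r then ε ^ (n + (r + 1) / 2) * tSum r (ones r) n else 0) ∧
      coeff r (recSeq ε 0 1 (2 * n + 1)) =
        (if Even r then ε ^ (n + r / 2) * tSum r (ones r) (n + 1) else 0) := by
  induction n with
  | zero =>
    intro r
    cases r with
    | zero => simp [recSeq, tSum]
    | succ r =>
      simp [recSeq, tSum_ones_succ, coeff_one]
      exact fun h1 h2 => absurd h2 (Nat.not_odd_iff_even.2 h1)
  | succ n ih =>
    have even_case : ∀ r, coeff r (recSeq ε 0 1 (2 * (n + 1))) =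
        (if Odd r then ε ^ (n + 1 + (r + 1) / 2) * tSum r (ones r) (n + 1) else 0) := by
      intro r
      rw [show 2 * (n + 1) = 2 * n + 2 by ring]
      cases r with
      | zero => rw [coeff_zero_recSeq, (ih 0).1]; simp
      | succ r =>
        rw [coeff_succ_recSeq, (ih (r + 1)).1, (ih r).2]
        by_cases hr : Even r
        · rw [if_pos hr, if_pos hr.add_one, if_pos hr.add_one, tSum_odd_succ hr,
            show n + 1 + (r + 1 + 1) / 2 = n + r / 2 + 2 by omega,
            show n + (r + 1 + 1) / 2 = n + r / 2 + 1 by omega]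
          push_cast
          linear_combination (-ε ^ (n + r / 2) * 2 / (2 * n + 1) * tSum r (ones r) (n + 1)) * hε
        · have h : ¬ Odd (r + 1) := by
            rw [Nat.not_odd_iff_even]
            exact (Nat.not_even_iff_odd.1 hr).add_one
          simp [hr, h]
    intro r
    refine ⟨even_case r, ?_⟩
    rw [show 2 * (n + 1) + 1 = 2 * n + 1 + 2 by ring]
    cases r with
    | zero => rw [coeff_zero_recSeq, (ih 0).2]; simp [tSum, pow_succ, mul_comm]
    | succ r =>
      rw [coeff_succ_recSeq, (ih (r + 1)).2, show 2 * n + 1 + 1 = 2 * (n + 1) by ring, even_case r]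
      by_cases hr : Odd r
      · rw [if_pos hr, if_pos hr.add_one, if_pos hr.add_one, tSum_even_succ hr,
          show n + 1 + (r + 1) / 2 = n + (r + 1) / 2 + 1 by omega]
        push_cast
        ring
      · have h : ¬ Even (r + 1) := by
          rw [Nat.not_even_iff_odd]
          exact (Nat.not_odd_iff_even.1 hr).add_one
        simp [hr, h]

lemma coeff_recSeq_one_zero (n : ℕ) : ∀ r,
    coeff r (recSeq 1 1 0 (2 * n)) = (if Even r then sSum r (ones r) n else 0) ∧
      coeff r (recSeq 1 1 0 (2 * n + 1)) = (if Odd r then sSum r (ones r) (n + 1) else 0) := by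
  induction n with
  | zero =>
    intro r
    cases r with
    | zero => simp [recSeq, sSum]
    | succ r =>
      simp [recSeq, sSum_ones_succ, coeff_one]
      exact fun h1 h2 => absurd h1 (Nat.not_odd_iff_even.2 h2)
  | succ n ih =>
    have even_case : ∀ r, coeff r (recSeq 1 1 0 (2 * (n + 1))) =
        (if Even r then sSum r (ones r) (n + 1) else 0) := by
      intro r
      rw [show 2 * (n + 1) = 2 * n + 2 by ring]
      cases r with
      | zero => rw [coeff_zero_recSeq, (ih 0).1]; simp [sSum]
      | succ r =>
        rw [coeff_succ_recSeq, (ih (r + 1)).1, (ih r).2]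
        by_cases hr : Odd r
        · rw [if_pos hr, if_pos hr.add_one, if_pos hr.add_one, sSum_even_succ hr]
          push_cast
          ring
        · have h : ¬ Even (r + 1) := by
            rw [Nat.not_even_iff_odd]
            exact (Nat.not_odd_iff_even.1 hr).add_one
          simp [hr, h]
    intro r
    refine ⟨even_case r, ?_⟩
    rw [show 2 * (n + 1) + 1 = 2 * n + 1 + 2 by ring]
    cases r with
    | zero => rw [coeff_zero_recSeq, (ih 0).2]; simp
    | succ r =>
      rw [coeff_succ_recSeq, (ih (r + 1)).2, show 2 * n + 1 + 1 = 2 * (n + 1) by ring, even_case r]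
      by_cases hr : Even r
      · rw [if_pos hr, if_pos hr.add_one, if_pos hr.add_one, sSum_odd_succ hr]
        push_cast
        ring
      · have h : ¬ Odd (r + 1) := by
          rw [Nat.not_odd_iff_even]
          exact (Nat.not_even_iff_odd.1 hr).add_one
        simp [hr, h]

/-! ### The Cayley transform of the unit interval -/

/-- `t ↦ 1 / (1 + t)` on `[0, 1]`. -/
def recip : C(I, ℝ) :=
  ⟨fun t => 1 / (1 + (t : ℝ)), by
    refine Continuous.div (by fun_prop) (by fun_prop) fun t => ?_
    have := t.2.1
    positivity⟩

lemma recip_mul (t : I) : recip t * (1 + t) = 1 := by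
  have : 1 + (t : ℝ) ≠ 0 := by
    have := t.2.1
    positivity
  simp [recip, this]

lemma recip_pos (t : I) : 0 < recip t := by
  have := t.2.1
  simp only [recip, ContinuousMap.coe_mk]
  positivity

lemma recip_le_one (t : I) : recip t ≤ 1 := by
  have := t.2.1
  nlinarith [recip_mul t, recip_pos t]

lemma recip_one : recip 1 = 1 / 2 := by simp [recip]; norm_num

lemma isDeriv_recip : IsDeriv recip (-(recip ^ 2)) := by
  refine ⟨fun t => 1 / (1 + t), fun _ => rfl, fun t => ?_⟩
  have h0 : 1 + (t : ℝ) ≠ 0 := by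
    have := t.2.1
    positivity
  have h := ((hasDerivAt_id (t : ℝ)).const_add 1).inv h0
  simp only [one_div]
  refine h.congr_deriv ?_
  simp [recip]
  ring

/-- `t ↦ (1 - t) / (1 + t)` on `[0, 1]`. -/
def cayley : C(I, ℝ) := (2 : ℝ) • recip - 1

lemma cayley_apply (t : I) : cayley t = 2 * recip t - 1 := by simp [cayley]

lemma cayley_nonneg (t : I) : 0 ≤ cayley t := by
  rw [cayley_apply]
  nlinarith [recip_mul t, recip_pos t, t.2.2]

lemma cayley_le_one (t : I) : cayley t ≤ 1 := by
  rw [cayley_apply]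
  linarith [recip_le_one t]

lemma cayley_one : cayley 1 = 0 := by rw [cayley_apply, recip_one]; norm_num

/-- The negative `2 / (1 + t)²` of the derivative of `cayley`. -/
def cayleyWeight : C(I, ℝ) := (2 : ℝ) • recip ^ 2

lemma cayleyWeight_apply (t : I) : cayleyWeight t = 2 * recip t ^ 2 := by simp [cayleyWeight]

lemma isDeriv_cayley : IsDeriv cayley (-cayleyWeight) := by
  have h := (isDeriv_recip.smul 2).sub IsDeriv.one
  rwa [sub_zero, smul_neg] at h

/-- The invariance of `2 dt / (1 + t²)` under the change of variable, up to orientation. -/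
lemma angleWeight_mul_cayley : angleWeight * (1 + cayley ^ 2) = (2 : ℝ) • cayleyWeight := by
  ext t
  have h1 : 1 + (t : ℝ) ≠ 0 := by
    have := t.2.1
    positivity
  have h2 : 1 + (t : ℝ) ^ 2 ≠ 0 := by positivity
  simp [angleWeight, cayley_apply, cayleyWeight_apply, recip]
  field_simp
  ring

lemma angleWeight_nonneg (t : I) : 0 ≤ angleWeight t := by
  simp only [angleWeight, ContinuousMap.coe_mk]
  positivity

lemma angleWeight_le (t : I) : angleWeight t ≤ 2 * cayleyWeight t := by
  have h := DFunLike.congr_fun angleWeight_mul_cayley t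
  simp at h
  nlinarith [angleWeight_nonneg t, sq_nonneg (cayley t)]

/-! ### Moments of powers of the Cayley transform -/

lemma recip_eq_geom_sum (N : ℕ) : recip = ∑ n ∈ Finset.range N, (-1 : ℝ) ^ n • coord ^ n +
    (-1 : ℝ) ^ N • (coord ^ N * recip) := by
  induction N with
  | zero => simp
  | succ N ih =>
    rw [Finset.sum_range_succ, add_assoc]
    refine ih.trans ?_
    congr 1
    ext t
    simp
    linear_combination ((-1) ^ N * (t : ℝ) ^ N) * recip_mul t

/-- The geometric expansion of `1 / (1 + t)` integrated term by term; the remainder has moment `O(1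
/ N)`. -/
lemma tendsto_zetaBar (q : ℕ) :
    Tendsto (fun N : ℕ => ∑ n ∈ Finset.Icc 1 N, zetaBarTerm (q + 1) n) atTop
      (𝓝 (coeff q (moments recip))) := by
  have h1 : ∀ N : ℕ, ∑ n ∈ Finset.Icc 1 N, zetaBarTerm (q + 1) n =
      coeff q (moments recip) - (-1) ^ N * coeff q (moments (coord ^ N * recip)) := by
    intro N
    rw [eq_sub_iff_add_eq]
    conv_rhs => rw [recip_eq_geom_sum N]
    rw [map_add, map_add, map_smul, PowerSeries.coeff_smul, smul_eq_mul, map_sum, map_sum]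
    congr 1
    rw [← Finset.Ico_add_one_right_eq_Icc, Finset.sum_Ico_eq_sum_range, Nat.add_sub_cancel]
    refine Finset.sum_congr rfl fun n _ => ?_
    rw [map_smul, PowerSeries.coeff_smul, coeff_moments_coord_pow, zetaBarTerm,
      Nat.add_sub_cancel_left, smul_eq_mul, mul_one_div]
    push_cast
    rw [add_comm (1 : ℝ)]
  simp only [h1]
  have h2 : Tendsto (fun N : ℕ => (-1) ^ N * coeff q (moments (coord ^ N * recip))) atTop
      (𝓝 0) := by
    have h3 : Tendsto (fun N : ℕ => ‖recip‖ / ((N : ℝ) + 1)) atTop (𝓝 0) :=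
      (Slow.const ‖recip‖).tendsto_div
    refine squeeze_zero_norm (fun N => ?_) h3
    rw [norm_mul, norm_pow, norm_neg, norm_one, one_pow, one_mul]
    exact abs_coeff_moments_coord_pow_mul_le recip q N
  simpa using h2.const_sub (coeff q (moments recip))

lemma zetaBarTerm_converges {s : ℕ} (hs : 1 ≤ s) : SeriesConverges (zetaBarTerm s) := by
  obtain ⟨q, rfl⟩ := Nat.exists_eq_add_of_le' hs
  exact ⟨_, tendsto_zetaBar q⟩

/-- Integration by parts with `h = 2 / (1 + t)`. The degree `0` coefficient is `h(1) = 1`, which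
accounts for the convention `ζ̄(0) = 1/2`. -/
lemma coeff_moments_cayleyWeight (q : ℕ) : coeff q (moments cayleyWeight) = 2 * zetaBar q := by
  have h := moments_add_coord_mul (isDeriv_recip.smul 2)
  have h1 : (2 : ℝ) • recip + coord * (2 : ℝ) • -(recip ^ 2) = cayleyWeight := by
    ext t
    simp [cayleyWeight_apply]
    linear_combination (-2 * recip t) * recip_mul t
  rw [h1] at h
  rw [h]
  cases q with
  | zero => simp [zetaBar, recip_one]
  | succ q =>
    have : zetaBar (q + 1) = coeff q (moments recip) := by
      rw [zetaBar, if_neg (by omega), series_eq (tendsto_zetaBar q)]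
    rw [this, map_add, coeff_succ_X_mul, map_smul]
    simp

/-- Moment series of `k ((1 - t) / (1 + t))^(k - 1) · 2 / (1 + t)²` with `k` replaced
by `k + 1`. -/
def cayleyMoment (k : ℕ) : ℝ⟦X⟧ := moments (((k : ℝ) + 1) • (cayley ^ k * cayleyWeight))

lemma moments_cayley (k : ℕ) :
    moments (((k : ℝ) + 1) • (cayley ^ k * cayleyWeight)) = cayleyMoment k := rfl

lemma cayleyMoment_one : cayleyMoment 1 = 1 + 2 * (X * cayleyMoment 0) := by
  have h := moments_add_coord_mul ((isDeriv_recip.pow_succ 1).smul (-4))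
  have h1 : (-4 : ℝ) • recip ^ (1 + 1) +
      coord * (-4 : ℝ) • (((1 : ℕ) : ℝ) + 1) • (recip ^ 1 * -(recip ^ 2)) =
      -((((1 : ℕ) : ℝ) + 1) • (cayley ^ 1 * cayleyWeight)) := by
    ext t
    simp [cayleyWeight_apply, cayley_apply]
    linear_combination (8 * recip t ^ 2) * recip_mul t
  have h2 : (-4 : ℝ) • recip ^ (1 + 1) =
      (-2 : ℝ) • ((((0 : ℕ) : ℝ) + 1) • (cayley ^ 0 * cayleyWeight)) := by
    ext t
    simp [cayleyWeight_apply]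
    ring
  have h3 : ((-4 : ℝ) • recip ^ (1 + 1)) 1 = -1 := by
    simp [recip_one]; norm_num
  rw [h1, h3, h2, map_neg, moments_cayley, map_smul, moments_cayley, smul_eq_C_mul] at h
  simp only [map_neg, map_one, map_ofNat] at h
  linear_combination -h

/-- Integration by parts with `h = -4 u^(k+1) / (1 + t)²`. Since `4 t / (1 + t)² = 1 - u²`, the
product `t h` is `u^(k+3) - u^(k+1)`, and `h` itself is a multiple of `u^(k+1)` times
`cayleyWeight`. The case of `cayleyMoment_one` is `h = -4 / (1 + t)²`, the only one with a boundary
value. -/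
lemma cayleyMoment_add_two (k : ℕ) : cayleyMoment (k + 2) =
    cayleyMoment k + C (2 / (((k + 1 : ℕ) : ℝ) + 1)) * (X * cayleyMoment (k + 1)) := by
  have h := moments_add_coord_mul
    (((isDeriv_recip.pow_succ 1).mul (isDeriv_cayley.pow_succ k)).smul (-4))
  set g := (-4 : ℝ) • ((((1 : ℕ) : ℝ) + 1) • (recip ^ 1 * -(recip ^ 2)) * cayley ^ (k + 1) +
    recip ^ (1 + 1) * (((k : ℝ) + 1) • (cayley ^ k * -cayleyWeight))) with hg
  have h1 : (-4 : ℝ) • (recip ^ (1 + 1) * cayley ^ (k + 1)) + coord * g =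
      (((k : ℝ) + 1) • (cayley ^ k * cayleyWeight)) -
        ((((k + 2 : ℕ) : ℝ) + 1) • (cayley ^ (k + 2) * cayleyWeight)) := by
    ext t
    simp [hg, cayleyWeight_apply]
    have e : cayley t = 2 * recip t - 1 := cayley_apply t
    rw [pow_succ (cayley t) k, pow_add (cayley t) k 2]
    generalize cayley t ^ k = z
    rw [e]
    linear_combination (z * (8 * recip t ^ 2 * (2 * recip t - 1) +
      8 * (k + 1) * recip t ^ 3)) * recip_mul t
  have h2 : (-4 : ℝ) • (recip ^ (1 + 1) * cayley ^ (k + 1)) =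
      (-(2 / (((k + 1 : ℕ) : ℝ) + 1))) •
        ((((k + 1 : ℕ) : ℝ) + 1) • (cayley ^ (k + 1) * cayleyWeight)) := by
    have h0 : (((k + 1 : ℕ) : ℝ) + 1) ≠ 0 := by positivity
    rw [smul_smul, neg_mul, div_mul_cancel₀ _ h0]
    ext t
    simp [cayleyWeight_apply]
    ring
  have h3 : ((-4 : ℝ) • (recip ^ (1 + 1) * cayley ^ (k + 1))) 1 = 0 := by
    simp [cayley_one]
  rw [h1, h3, h2, map_sub, moments_cayley, moments_cayley, map_smul, moments_cayley,
    smul_eq_C_mul] at h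
  simp only [map_neg, map_zero] at h
  linear_combination -h

lemma cayleyMoment_eq (k : ℕ) : cayleyMoment k =
    moments cayleyWeight * recSeq 1 0 1 (k + 1) + recSeq 1 1 0 (k + 1) := by
  have h0 : cayleyMoment 0 = moments cayleyWeight := by simp [cayleyMoment]
  have key : ∀ k, cayleyMoment k =
        moments cayleyWeight * recSeq 1 0 1 (k + 1) + recSeq 1 1 0 (k + 1) ∧
      cayleyMoment (k + 1) =
        moments cayleyWeight * recSeq 1 0 1 (k + 2) + recSeq 1 1 0 (k + 2) := by
    intro k
    induction k with
    | zero =>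
      refine ⟨by simp [h0, recSeq], ?_⟩
      rw [cayleyMoment_one, h0]
      simp [recSeq, map_ofNat C 2]
      ring
    | succ k ih =>
      refine ⟨ih.2, ?_⟩
      rw [cayleyMoment_add_two, ih.1, ih.2]
      have h : ∀ a b : ℝ⟦X⟧, recSeq 1 a b (k + 1 + 2) = recSeq 1 a b (k + 1) +
          C (2 / (((k + 1 : ℕ) : ℝ) + 1)) * (X * recSeq 1 a b (k + 2)) := fun a b => by
        simp [recSeq]
      rw [h, h]
      ring
  exact (key k).1

lemma coeff_cayleyMoment_slow (q : ℕ) : Slow fun k => coeff q (cayleyMoment k) := by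
  simp only [cayleyMoment_eq, map_add, coeff_mul]
  refine Slow.add (Slow.sum _ fun ab _ => ?_) ?_
  · exact ((coeff_recSeq_slow (by simp) 0 1 ab.2).succ).const_mul _
  · exact (coeff_recSeq_slow (by simp) 1 0 q).succ

/-! ### Power series expansion of the iterated integrals in the Cayley variable -/

lemma nonneg_of_deriv_nonpos {g g' : C(I, ℝ)} (h : IsDeriv g g') (h' : ∀ t, g' t ≤ 0)
    (h1 : g 1 = 0) (t : I) : 0 ≤ g t := by
  obtain ⟨G, hG, hG'⟩ := h
  have hd : ∀ x ∈ Set.Icc (0 : ℝ) 1, ∃ y ≤ 0, HasDerivAt G y x :=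
    fun x hx => ⟨g' ⟨x, hx⟩, h' _, hG' ⟨x, hx⟩⟩
  have hanti : AntitoneOn G (Set.Icc 0 1) := by
    refine antitoneOn_of_deriv_nonpos (convex_Icc 0 1) (fun x hx => ?_) (fun x hx => ?_)
      (fun x hx => ?_)
    · obtain ⟨y, -, hy⟩ := hd x hx
      exact hy.continuousAt.continuousWithinAt
    · obtain ⟨y, -, hy⟩ := hd x (interior_subset hx)
      exact hy.differentiableAt.differentiableWithinAt
    · obtain ⟨y, h0, hy⟩ := hd x (interior_subset hx)
      rwa [hy.deriv]
  have := hanti t.2 (Set.right_mem_Icc.2 zero_le_one) t.2.2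
  rw [hG t] at this
  have h2 : G 1 = 0 := by rw [← h1, ← hG 1]; rfl
  rwa [h2] at this

/-- Comparison from the endpoint `1`, where `u = 0` and all the Taylor expansions are anchored. -/
lemma abs_le_of_deriv_le {f f' g g' : C(I, ℝ)} (hf : IsDeriv f f') (hg : IsDeriv g g')
    (h : ∀ t, |f' t| ≤ -g' t) (hf1 : f 1 = 0) (hg1 : g 1 = 0) (t : I) : |f t| ≤ g t := by
  rw [abs_le]
  constructor
  · have := nonneg_of_deriv_nonpos (hg.add hf)
      (fun t => by
        have := (abs_le.1 (h t)).2
        simp only [ContinuousMap.add_apply]; linarith) (by simp [hf1, hg1]) t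
    simp only [ContinuousMap.add_apply] at this
    linarith
  · have := nonneg_of_deriv_nonpos (hg.sub hf)
      (fun t => by
        have := (abs_le.1 (h t)).1
        simp only [ContinuousMap.sub_apply]; linarith) (by simp [hf1, hg1]) t
    simp only [ContinuousMap.sub_apply] at this
    linarith

/-- The Taylor coefficients of the divided powers of `2 arctan`, up to a factor `2 / k`. -/
def arctanCoeff (r k : ℕ) : ℝ := coeff r (recSeq (-1) 0 1 k)

lemma arctanCoeff_slow (r : ℕ) : Slow (arctanCoeff r) := coeff_recSeq_slow (by simp) 0 1 r

/-- Partial Taylor sums of `(2 arctan)^r / r!` in the Cayley variable. -/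
def approx : ℕ → ℕ → C(I, ℝ)
  | 0, _ => 1
  | r + 1, K => ∑ k ∈ Finset.range K,
      (2 * arctanCoeff r (k + 1) / ((k : ℝ) + 1)) • cayley ^ (k + 1)

/-- The derivative of `approx (r + 1) K` with respect to the Cayley variable. -/
def approxDeriv (r K : ℕ) : C(I, ℝ) :=
  ∑ k ∈ Finset.range K, (2 * arctanCoeff r (k + 1)) • cayley ^ k

lemma isDeriv_approx (r K : ℕ) :
    IsDeriv (approx (r + 1) K) (-(cayleyWeight * approxDeriv r K)) := by
  have h : -(cayleyWeight * approxDeriv r K) = ∑ k ∈ Finset.range K,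
      (2 * arctanCoeff r (k + 1) / ((k : ℝ) + 1)) •
        (((k : ℝ) + 1) • (cayley ^ k * -cayleyWeight)) := by
    rw [approxDeriv, Finset.mul_sum, ← Finset.sum_neg_distrib]
    refine Finset.sum_congr rfl fun k _ => ?_
    have h0 : (k : ℝ) + 1 ≠ 0 := by positivity
    rw [smul_smul, div_mul_cancel₀ _ h0, mul_smul_comm, mul_neg, smul_neg, mul_comm cayleyWeight]
  rw [h]
  exact IsDeriv.sum _ fun k _ => (isDeriv_cayley.pow_succ k).smul _

lemma approx_succ_one (r K : ℕ) : approx (r + 1) K 1 = 0 := by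
  simp [approx, ContinuousMap.sum_apply, cayley_one]

/-- The recursion for `arctanCoeff` is the equation `(1 + u²) F_{r+1}' = 2 F_r` for `F_r = (2 arctan
u)^r / r!`, read off in powers of `u`. Truncation breaks it only in the two top degrees. -/
lemma one_add_sq_mul_approxDeriv (r K : ℕ) : (1 + cayley ^ 2) * approxDeriv r (K + 1) =
    (2 : ℝ) • approx r K + (2 * arctanCoeff r K) • cayley ^ (K + 1) +
      (2 * arctanCoeff r (K + 1)) • cayley ^ (K + 2) := by
  induction K with
  | zero =>
    cases r with
    | zero =>
      ext t
      simp [approxDeriv, approx, arctanCoeff, recSeq]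
    | succ r =>
      ext t
      simp [approxDeriv, approx, arctanCoeff, recSeq, coeff_one]
  | succ K ih =>
    rw [approxDeriv, Finset.sum_range_succ, ← approxDeriv, mul_add, ih]
    cases r with
    | zero =>
      have h : arctanCoeff 0 (K + 2) = -1 * arctanCoeff 0 K := coeff_zero_recSeq _ _ _ _
      ext t
      simp [approx, h]
      ring
    | succ r =>
      have h : arctanCoeff (r + 1) (K + 2) = -1 * arctanCoeff (r + 1) K +
        2 / ((K : ℝ) + 1) * arctanCoeff r (K + 1) := coeff_succ_recSeq _ _ _ _ _
      have h' : approx (r + 1) (K + 1) = approx (r + 1) K +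
          (2 * arctanCoeff r (K + 1) / ((K : ℝ) + 1)) • cayley ^ (K + 1) := by
        rw [approx, Finset.sum_range_succ, ← approx]
      rw [h']
      ext t
      simp [h]
      ring

lemma cayleyWeight_mul_approxDeriv (r K : ℕ) : cayleyWeight * approxDeriv r (K + 1) =
    angleWeight * approx r K + angleWeight * (arctanCoeff r K • cayley ^ (K + 1) +
      arctanCoeff r (K + 1) • cayley ^ (K + 2)) := by
  have h1 := one_add_sq_mul_approxDeriv r K
  have h2 := angleWeight_mul_cayley
  ext t
  have h1' := DFunLike.congr_fun h1 t
  have h2' := DFunLike.congr_fun h2 t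
  simp at h1' h2' ⊢
  linear_combination (-(1 / 2) * approxDeriv r (K + 1) t) * h2' + (1 / 2 * angleWeight t) * h1'

lemma angle_le_two (t : I) : angle t ≤ 2 := by
  have h1 : 0 ≤ Real.arctan t := Real.arctan_nonneg.2 t.2.1
  simp only [angle, ContinuousMap.coe_mk]
  linarith [Real.pi_le_four]

lemma abs_approx_sub_le (r K : ℕ) (t : I) :
    |(approx (r + 1) (K + 1) - anglePow (r + 1)) t| ≤ ‖approx r K - anglePow r‖ * 2 +
      2 * (|arctanCoeff r K| + |arctanCoeff r (K + 1)|) / ((K : ℝ) + 1) := by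
  set e := ‖approx r K - anglePow r‖ with he
  set c := |arctanCoeff r K| + |arctanCoeff r (K + 1)| with hc
  have hc0 : 0 ≤ c := by positivity
  have hf := (isDeriv_approx r (K + 1)).sub (isDeriv_anglePow_succ r)
  -- The majorant is `e · angle + 2c / (K + 2) · u^(K+2)`. Its first part absorbs the error of the
  -- previous level, its second the two truncation terms, by `angleWeight ≤ 2 * cayleyWeight`.
  have hg := (isDeriv_angle.smul e).add
    ((isDeriv_cayley.pow_succ (K + 1)).smul (2 * c / (((K + 1 : ℕ) : ℝ) + 1)))
  have hK : (((K + 1 : ℕ) : ℝ) + 1) ≠ 0 := by positivity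
  refine (abs_le_of_deriv_le hf hg (fun s => ?_) ?_ ?_ t).trans ?_
  · have h1 : |(approx r K - anglePow r) s| ≤ e := (approx r K - anglePow r).norm_coe_le_norm s
    have h2 : cayley s ^ (K + 2) ≤ cayley s ^ (K + 1) :=
      pow_le_pow_of_le_one (cayley_nonneg s) (cayley_le_one s) (by omega)
    have h3 : 0 ≤ cayley s ^ (K + 1) := pow_nonneg (cayley_nonneg s) _
    have h3' : 0 ≤ cayley s ^ (K + 2) := pow_nonneg (cayley_nonneg s) _
    have h4 : |arctanCoeff r K * cayley s ^ (K + 1) + arctanCoeff r (K + 1) * cayley s ^ (K + 2)| ≤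
        c * cayley s ^ (K + 1) := by
      refine (abs_add_le _ _).trans ?_
      rw [abs_mul, abs_mul, abs_of_nonneg h3, abs_of_nonneg h3', hc, add_mul]
      gcongr
    rw [cayleyWeight_mul_approxDeriv]
    simp only [ContinuousMap.sub_apply, ContinuousMap.neg_apply, ContinuousMap.add_apply,
      ContinuousMap.mul_apply, ContinuousMap.smul_apply, ContinuousMap.pow_apply, smul_eq_mul] at h1 ⊢
    have e1 : -(angleWeight s * approx r K s + angleWeight s *
        (arctanCoeff r K * cayley s ^ (K + 1) + arctanCoeff r (K + 1) * cayley s ^ (K + 2))) -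
        -(angleWeight s * anglePow r s) = -(angleWeight s * ((approx r K s - anglePow r s) +
        (arctanCoeff r K * cayley s ^ (K + 1) + arctanCoeff r (K + 1) * cayley s ^ (K + 2)))) := by
      ring
    have e2 : -(e * -angleWeight s + 2 * c / (((K + 1 : ℕ) : ℝ) + 1) *
        ((((K + 1 : ℕ) : ℝ) + 1) * (cayley s ^ (K + 1) * -cayleyWeight s))) =
        angleWeight s * e + (2 * cayleyWeight s) * (c * cayley s ^ (K + 1)) := by
      field_simp
      ring
    rw [e1, e2, abs_neg, abs_mul, abs_of_nonneg (angleWeight_nonneg s)]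
    have h5 := angleWeight_nonneg s
    calc _ ≤ angleWeight s * (e + c * cayley s ^ (K + 1)) := by
          gcongr
          exact (abs_add_le _ _).trans (add_le_add h1 h4)
      _ = angleWeight s * e + angleWeight s * (c * cayley s ^ (K + 1)) := mul_add _ _ _
      _ ≤ _ := by
          gcongr
          exact angleWeight_le s
  · simp [approx_succ_one, anglePow_succ_one]
  · simp [angle_one, cayley_one]
  · simp only [ContinuousMap.add_apply, ContinuousMap.smul_apply, ContinuousMap.pow_apply,
      smul_eq_mul]
    have h1 : cayley t ^ (K + 1 + 1) ≤ 1 := pow_le_one₀ (cayley_nonneg t) (cayley_le_one t)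
    have h2 := angle_le_two t
    have h3 : 2 * c / (((K + 1 : ℕ) : ℝ) + 1) ≤ 2 * c / ((K : ℝ) + 1) := by
      push_cast
      gcongr
      linarith
    have h4 : 2 * c / (((K + 1 : ℕ) : ℝ) + 1) * cayley t ^ (K + 1 + 1) ≤
        2 * c / (((K + 1 : ℕ) : ℝ) + 1) * 1 := by gcongr
    have h5 : e * angle t ≤ e * 2 := by gcongr
    linarith

/-- Uniform convergence up to `u = 1`, by induction on `r`: the error doubles at most, plus a
polylogarithmic term over `K + 1`. -/
lemma tendsto_approx (r : ℕ) :
    Tendsto (fun K => ‖approx r K - anglePow r‖) atTop (𝓝 0) := by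
  induction r with
  | zero => simp [approx]
  | succ r ih =>
    rw [← tendsto_add_atTop_iff_nat 1]
    have hs : Slow fun K => 2 * (|arctanCoeff r K| + |arctanCoeff r (K + 1)|) := by
      have h := (arctanCoeff_slow r).mono (a := fun K => |arctanCoeff r K|) fun n => by simp
      exact (h.add h.succ).const_mul 2
    have h := (ih.mul_const 2).add hs.tendsto_div
    rw [zero_mul, zero_add] at h
    refine squeeze_zero (fun _ => norm_nonneg _) (fun K => ?_) h
    rw [ContinuousMap.norm_le _ (by positivity)]
    exact fun t => abs_approx_sub_le r K t

lemma abs_coeff_moments_le_norm (f : C(I, ℝ)) (q : ℕ) : |coeff q (moments f)| ≤ ‖f‖ := by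
  simpa using abs_coeff_moments_coord_pow_mul_le f q 0

/-- The sup norm of `u^N` does not decay, so the gain `1 / (N + 1)` has to come from the moment
itself, by comparison with `cayleyMoment`. -/
lemma abs_coeff_moments_angleWeight_mul_le (q N : ℕ) :
    |coeff q (moments (angleWeight * cayley ^ N))| ≤ 2 * coeff q (cayleyMoment N) / ((N : ℝ) + 1) := by
  have h0 : (N : ℝ) + 1 ≠ 0 := by positivity
  have h : 2 * coeff q (cayleyMoment N) / ((N : ℝ) + 1) =
      coeff q (moments ((2 : ℝ) • (cayley ^ N * cayleyWeight))) := by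
    simp only [cayleyMoment, map_smul, smul_eq_mul]
    field_simp
  rw [h]
  refine abs_coeff_moments_le (fun t => ?_) q
  have h3 : 0 ≤ cayley t ^ N := pow_nonneg (cayley_nonneg t) _
  simp only [ContinuousMap.mul_apply, ContinuousMap.pow_apply, ContinuousMap.smul_apply,
    smul_eq_mul]
  rw [abs_mul, abs_of_nonneg h3, abs_of_nonneg (angleWeight_nonneg t)]
  nlinarith [mul_le_mul_of_nonneg_right (angleWeight_le t) h3]

lemma tendsto_arctanCoeff_mul (r q : ℕ) : Tendsto (fun K => arctanCoeff r K *
    coeff q (moments (angleWeight * cayley ^ (K + 1)))) atTop (𝓝 0) := by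
  have h := (((arctanCoeff_slow r).mul ((coeff_cayleyMoment_slow q).succ)).const_mul 2).tendsto_div
  refine squeeze_zero_norm (fun K => ?_) (tendsto_norm_zero.comp h)
  have h1 := abs_coeff_moments_angleWeight_mul_le q (K + 1)
  have h2 : 0 ≤ 2 * coeff q (cayleyMoment (K + 1)) / (((K + 1 : ℕ) : ℝ) + 1) :=
    (abs_nonneg _).trans h1
  have h3 : 0 ≤ coeff q (cayleyMoment (K + 1)) := by
    have h4 : (0 : ℝ) < ((K + 1 : ℕ) : ℝ) + 1 := by positivity
    have h5 := mul_nonneg h2 h4.le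
    rw [div_mul_cancel₀ _ h4.ne'] at h5
    linarith
  rw [Function.comp, norm_mul, Real.norm_eq_abs, Real.norm_eq_abs, Real.norm_eq_abs, abs_div,
    abs_mul, abs_mul, abs_of_nonneg h3, abs_two, abs_of_pos (by positivity : (0 : ℝ) < K + 1)]
  calc _ ≤ |arctanCoeff r K| * (2 * coeff q (cayleyMoment (K + 1)) / ((K : ℝ) + 1)) := by
        gcongr
        refine h1.trans ?_
        gcongr
        linarith
    _ = _ := by ring

/-- Termwise integration of the Taylor expansion, up to the boundary point. -/
lemma tendsto_sum_arctanCoeff (r q : ℕ) :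
    Tendsto (fun K : ℕ => ∑ k ∈ Finset.Icc 1 K,
      2 * arctanCoeff r k / k * coeff q (cayleyMoment (k - 1))) atTop
      (𝓝 (coeff q (moments (anglePow r * angleWeight)))) := by
  have hsum : ∀ K, ∑ k ∈ Finset.Icc 1 K, 2 * arctanCoeff r k / k * coeff q (cayleyMoment (k - 1)) =
      coeff q (moments (cayleyWeight * approxDeriv r K)) := by
    intro K
    rw [← Finset.Ico_add_one_right_eq_Icc, Finset.sum_Ico_eq_sum_range, Nat.add_sub_cancel,
      approxDeriv, Finset.mul_sum, map_sum, map_sum]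
    refine Finset.sum_congr rfl fun k _ => ?_
    have h0 : (k : ℝ) + 1 ≠ 0 := by positivity
    rw [Nat.add_sub_cancel_left, mul_smul_comm, map_smul, PowerSeries.coeff_smul, cayleyMoment,
      map_smul, PowerSeries.coeff_smul, smul_eq_mul, smul_eq_mul, mul_comm cayleyWeight,
      add_comm 1 k]
    push_cast
    field_simp
  simp only [hsum]
  rw [← tendsto_add_atTop_iff_nat 1]
  -- By `cayleyWeight_mul_approxDeriv` the error has three parts: the uniform error of `approx`, and
  -- the two truncation terms, treated by `h2` and its shift `h3`.
  have h1 : Tendsto (fun K => coeff q (moments (angleWeight * (approx r K - anglePow r)))) atTop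
      (𝓝 0) := by
    have h := (tendsto_approx r).const_mul ‖angleWeight‖
    rw [mul_zero] at h
    exact squeeze_zero_norm
      (fun K => (abs_coeff_moments_le_norm _ q).trans (norm_mul_le _ _)) h
  have h2 := tendsto_arctanCoeff_mul r q
  have h3 := h2.comp (tendsto_add_atTop_nat 1)
  have h4 := ((h1.add h2).add h3).add_const (coeff q (moments (anglePow r * angleWeight)))
  rw [add_zero, add_zero, zero_add] at h4
  refine h4.congr fun K => ?_
  rw [cayleyWeight_mul_approxDeriv, mul_sub, mul_add angleWeight, mul_smul_comm, mul_smul_comm,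
    mul_comm (anglePow r)]
  simp only [map_add, map_sub, map_smul, smul_eq_mul, Function.comp]
  ring

/-! ### The general form of the formulas -/

lemma sum_Icc_two_mul (g : ℕ → ℝ) (N : ℕ) :
    ∑ k ∈ Finset.Icc 1 (2 * N), g k = ∑ n ∈ Finset.Icc 1 N, (g (2 * n - 1) + g (2 * n)) := by
  induction N with
  | zero => simp
  | succ N ih =>
    rw [Finset.sum_Icc_succ_top (by omega), ← ih, show 2 * (N + 1) = 2 * N + 1 + 1 by ring,
      Finset.sum_Icc_succ_top (by omega), Finset.sum_Icc_succ_top (by omega), add_assoc]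
    simp

lemma coeff_cayleyMoment (q k : ℕ) : coeff q (cayleyMoment k) =
    ∑ ab ∈ Finset.HasAntidiagonal.antidiagonal q,
      2 * zetaBar ab.1 * coeff ab.2 (recSeq 1 0 1 (k + 1)) + coeff q (recSeq 1 1 0 (k + 1)) := by
  simp only [cayleyMoment_eq, map_add, coeff_mul, coeff_moments_cayleyWeight]

/-- In even depth the Taylor coefficients vanish at odd `k`; the term at `k = 2n` gives the
denominator `n` and the product of `T_n` with the degree `q` part of `cayleyMoment`. -/
lemma W_even (m q : ℕ) (hm : 1 ≤ m) : W (2 * m + q) (2 * m) = (-1) ^ m *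
    (∑ ab ∈ Finset.HasAntidiagonal.antidiagonal q,
      (if Odd ab.2 then 2 * zetaBar ab.1 * series (termTTEven (2 * m - 1) ab.2) else 0) +
        if Even q then series (termTSEven (2 * m - 1) q) else 0) := by
  obtain ⟨m, rfl⟩ := Nat.exists_eq_add_of_le' hm
  have hr : Odd (2 * m + 1) := odd_two_mul_add_one m
  have hr' : ¬ Even (2 * m + 1) := Nat.not_even_iff_odd.2 hr
  -- Partial sums of even length `2N` suffice, since the limit is known to exist; they group into
  -- pairs `k = 2n - 1, 2n`.
  have h1 := (tendsto_sum_arctanCoeff (2 * m + 1) q).comp (tendsto_id.const_mul_atTop' two_pos)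
  rw [show 2 * (m + 1) = 2 * m + 1 + 1 by ring, W_eq_coeff, Nat.add_sub_cancel]
  have h2 : Tendsto (fun N : ℕ => (-1) ^ (m + 1) *
      (∑ ab ∈ Finset.HasAntidiagonal.antidiagonal q, (if Odd ab.2 then 2 * zetaBar ab.1 *
        ∑ n ∈ Finset.Icc 1 N, termTTEven (2 * m + 1) ab.2 n else 0) +
        if Even q then ∑ n ∈ Finset.Icc 1 N, termTSEven (2 * m + 1) q n else 0)) atTop
      (𝓝 ((-1) ^ (m + 1) * (∑ ab ∈ Finset.HasAntidiagonal.antidiagonal q,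
      (if Odd ab.2 then 2 * zetaBar ab.1 * series (termTTEven (2 * m + 1) ab.2) else 0) +
        if Even q then series (termTSEven (2 * m + 1) q) else 0))) := by
    refine ((tendsto_finsetSum _ fun ab _ => ?_).add ?_).const_mul _
    · split_ifs
      · exact (termTTEven_converges _ _).tendsto.const_mul _
      · exact tendsto_const_nhds
    · split_ifs
      · exact (termTSEven_converges _ _).tendsto
      · exact tendsto_const_nhds
  rw [← tendsto_nhds_unique h2 (h1.congr fun N => ?_), pow_succ _ (2 * m + 1), hr.neg_one_pow]
  · ring
  simp only [Function.comp, id, sum_Icc_two_mul]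
  have h3 : ∀ n ∈ Finset.Icc 1 N,
      2 * arctanCoeff (2 * m + 1) (2 * n - 1) / ((2 * n - 1 : ℕ) : ℝ) *
          coeff q (cayleyMoment (2 * n - 1 - 1)) +
        2 * arctanCoeff (2 * m + 1) (2 * n) / ((2 * n : ℕ) : ℝ) *
          coeff q (cayleyMoment (2 * n - 1)) =
      (-1) ^ (m + 1) * (∑ ab ∈ Finset.HasAntidiagonal.antidiagonal q,
        (if Odd ab.2 then 2 * zetaBar ab.1 * termTTEven (2 * m + 1) ab.2 n else 0) +
        if Even q then termTSEven (2 * m + 1) q n else 0) := by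
    intro n hn
    obtain ⟨l, rfl⟩ := Nat.exists_eq_add_of_le' (Finset.mem_Icc.1 hn).1
    have e1 : arctanCoeff (2 * m + 1) (2 * (l + 1) - 1) = 0 := by
      rw [show 2 * (l + 1) - 1 = 2 * l + 1 by omega, arctanCoeff,
        (coeff_recSeq_zero_one (by norm_num) l _).2, if_neg hr']
    have e2 : arctanCoeff (2 * m + 1) (2 * (l + 1)) = (-1) ^ (m + 1) * (-1) ^ (l + 1) *
        tSum (2 * m + 1) (ones (2 * m + 1)) (l + 1) := by
      rw [arctanCoeff, (coeff_recSeq_zero_one (by norm_num) (l + 1) _).1, if_pos hr,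
        show (2 * m + 1 + 1) / 2 = m + 1 by omega, pow_add, mul_comm ((-1) ^ (l + 1))]
    rw [e1, e2, mul_zero, zero_div, zero_mul, zero_add, coeff_cayleyMoment,
      show 2 * (l + 1) - 1 + 1 = 2 * (l + 1) by omega,
      (coeff_recSeq_one_zero (l + 1) q).1, mul_add (_ / _), mul_add ((-1 : ℝ) ^ (m + 1)), Finset.mul_sum, Finset.mul_sum]
    congr 1
    · refine Finset.sum_congr rfl fun ab _ => ?_
      rw [(coeff_recSeq_zero_one (by norm_num) (l + 1) _).1]
      split_ifs
      · rw [one_pow, termTTEven]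
        push_cast
        field_simp
      · simp
    · split_ifs
      · rw [termTSEven]
        push_cast
        field_simp
      · simp
  rw [Finset.sum_congr rfl h3, ← Finset.mul_sum, Finset.sum_add_distrib, Finset.sum_comm]
  congr 2
  · refine Finset.sum_congr rfl fun ab _ => ?_
    split_ifs
    · rw [Finset.mul_sum]
    · simp
  · split_ifs <;> simp

/-- In odd depth only `k = 2n - 1` contributes. Compared with `W_even`, the denominator `2n - 1`
replaces `2n`, whose factor `2` was cancelled there, hence the extra factor `2` in both terms. -/
lemma W_odd (m q : ℕ) (hm : 1 ≤ m) : W (2 * m - 1 + q) (2 * m - 1) = (-1) ^ (m - 1) *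
    (∑ ab ∈ Finset.HasAntidiagonal.antidiagonal q,
      (if Even ab.2 then 4 * zetaBar ab.1 * series (termTTOdd (2 * m - 2) ab.2) else 0) +
        if Odd q then 2 * series (termTSOdd (2 * m - 2) q) else 0) := by
  obtain ⟨m, rfl⟩ := Nat.exists_eq_add_of_le' hm
  have hr : Even (2 * m) := even_two_mul m
  have hr' : ¬ Odd (2 * m) := Nat.not_odd_iff_even.2 hr
  have h1 := (tendsto_sum_arctanCoeff (2 * m) q).comp (tendsto_id.const_mul_atTop' two_pos)
  rw [show 2 * (m + 1) - 1 = 2 * m + 1 by omega, W_eq_coeff, Nat.add_sub_cancel,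
    show 2 * (m + 1) - 2 = 2 * m by omega]
  have h2 : Tendsto (fun N : ℕ => (-1) ^ (m + 1) *
      (∑ ab ∈ Finset.HasAntidiagonal.antidiagonal q, (if Even ab.2 then 4 * zetaBar ab.1 *
        ∑ n ∈ Finset.Icc 1 N, termTTOdd (2 * m) ab.2 n else 0) +
        if Odd q then 2 * ∑ n ∈ Finset.Icc 1 N, termTSOdd (2 * m) q n else 0)) atTop
      (𝓝 ((-1) ^ (m + 1) * (∑ ab ∈ Finset.HasAntidiagonal.antidiagonal q,
      (if Even ab.2 then 4 * zetaBar ab.1 * series (termTTOdd (2 * m) ab.2) else 0) +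
        if Odd q then 2 * series (termTSOdd (2 * m) q) else 0))) := by
    refine ((tendsto_finsetSum _ fun ab _ => ?_).add ?_).const_mul _
    · split_ifs
      · exact (termTTOdd_converges _ _).tendsto.const_mul _
      · exact tendsto_const_nhds
    · split_ifs
      · exact (termTSOdd_converges _ _).tendsto.const_mul _
      · exact tendsto_const_nhds
  rw [← tendsto_nhds_unique h2 (h1.congr fun N => ?_), pow_succ _ (2 * m), hr.neg_one_pow]
  · ring
  simp only [Function.comp, id, sum_Icc_two_mul]
  have h3 : ∀ n ∈ Finset.Icc 1 N,
      2 * arctanCoeff (2 * m) (2 * n - 1) / ((2 * n - 1 : ℕ) : ℝ) *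
          coeff q (cayleyMoment (2 * n - 1 - 1)) +
        2 * arctanCoeff (2 * m) (2 * n) / ((2 * n : ℕ) : ℝ) *
          coeff q (cayleyMoment (2 * n - 1)) =
      (-1) ^ (m + 1) * (∑ ab ∈ Finset.HasAntidiagonal.antidiagonal q,
        (if Even ab.2 then 4 * zetaBar ab.1 * termTTOdd (2 * m) ab.2 n else 0) +
        if Odd q then 2 * termTSOdd (2 * m) q n else 0) := by
    intro n hn
    obtain ⟨l, rfl⟩ := Nat.exists_eq_add_of_le' (Finset.mem_Icc.1 hn).1
    have e1 : arctanCoeff (2 * m) (2 * (l + 1)) = 0 := by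
      rw [arctanCoeff, (coeff_recSeq_zero_one (by norm_num) (l + 1) _).1, if_neg hr']
    have e2 : arctanCoeff (2 * m) (2 * (l + 1) - 1) = (-1) ^ (m + 1) * (-1) ^ (l + 1) *
        tSum (2 * m) (ones (2 * m)) (l + 1) := by
      rw [show 2 * (l + 1) - 1 = 2 * l + 1 by omega, arctanCoeff,
        (coeff_recSeq_zero_one (by norm_num) l _).2, if_pos hr,
        show 2 * m / 2 = m by omega]
      ring
    have e3 : (2 * ((l + 1 : ℕ) : ℝ) - 1) = ((2 * (l + 1) - 1 : ℕ) : ℝ) := by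
      rw [Nat.cast_sub (by omega)]
      push_cast
      ring
    rw [e1, e2, coeff_cayleyMoment, show 2 * (l + 1) - 1 - 1 + 1 = 2 * l + 1 by omega,
      (coeff_recSeq_one_zero l q).2, mul_zero, zero_div, zero_mul, add_zero,
      mul_add (_ / _), mul_add ((-1 : ℝ) ^ (m + 1)),
      Finset.mul_sum, Finset.mul_sum]
    congr 1
    · refine Finset.sum_congr rfl fun ab _ => ?_
      rw [(coeff_recSeq_zero_one (by norm_num) l _).2]
      split_ifs
      · rw [one_pow, termTTOdd, e3]
        ring
      · simp
    · split_ifs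
      · rw [termTSOdd, e3]
        ring
      · simp
  rw [Finset.sum_congr rfl h3, ← Finset.mul_sum, Finset.sum_add_distrib, Finset.sum_comm]
  congr 2
  · refine Finset.sum_congr rfl fun ab _ => ?_
    split_ifs
    · rw [Finset.mul_sum]
    · simp
  · split_ifs
    · rw [Finset.mul_sum]
    · simp

/-! ### Reindexing antidiagonal sums by parity -/

lemma sum_range_two_mul (g : ℕ → ℝ) (p : ℕ) :
    ∑ b ∈ Finset.range (2 * p), g b = ∑ j ∈ Finset.range p, (g (2 * j) + g (2 * j + 1)) := by
  induction p with
  | zero => simp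
  | succ p ih =>
    rw [show 2 * (p + 1) = 2 * p + 1 + 1 by ring, Finset.sum_range_succ, Finset.sum_range_succ, ih,
      Finset.sum_range_succ, add_assoc]

lemma sum_antidiagonal_eq (q : ℕ) (f : ℕ → ℕ → ℝ) :
    ∑ ab ∈ Finset.HasAntidiagonal.antidiagonal q, f ab.1 ab.2 =
      ∑ b ∈ Finset.range (q + 1), f (q - b) b := by
  rw [← Finset.Nat.sum_antidiagonal_swap]
  exact Finset.Nat.sum_antidiagonal_eq_sum_range_succ (fun b a => f a b) q

lemma sum_antidiagonal_odd_of_odd (p : ℕ) (f : ℕ → ℕ → ℝ) :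
    ∑ ab ∈ Finset.HasAntidiagonal.antidiagonal (2 * p + 1),
      (if Odd ab.2 then f ab.1 ab.2 else 0) =
      ∑ j ∈ Finset.range (p + 1), f (2 * p - 2 * j) (2 * j + 1) := by
  rw [sum_antidiagonal_eq _ fun a b => if Odd b then f a b else 0,
    show 2 * p + 1 + 1 = 2 * (p + 1) by ring, sum_range_two_mul]
  refine Finset.sum_congr rfl fun j _ => ?_
  rw [if_neg (by simp), if_pos (by simp), zero_add]
  congr 1
  omega

lemma sum_antidiagonal_even_of_odd (p : ℕ) (f : ℕ → ℕ → ℝ) :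
    ∑ ab ∈ Finset.HasAntidiagonal.antidiagonal (2 * p + 1),
      (if Even ab.2 then f ab.1 ab.2 else 0) =
      ∑ j ∈ Finset.range (p + 1), f (2 * p + 1 - 2 * j) (2 * j) := by
  rw [sum_antidiagonal_eq _ fun a b => if Even b then f a b else 0,
    show 2 * p + 1 + 1 = 2 * (p + 1) by ring, sum_range_two_mul]
  refine Finset.sum_congr rfl fun j _ => ?_
  rw [if_pos (by simp), if_neg (by simp), add_zero]

lemma sum_antidiagonal_odd_of_even (p : ℕ) (f : ℕ → ℕ → ℝ) :
    ∑ ab ∈ Finset.HasAntidiagonal.antidiagonal (2 * p),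
      (if Odd ab.2 then f ab.1 ab.2 else 0) =
      ∑ j ∈ Finset.range p, f (2 * p - 1 - 2 * j) (2 * j + 1) := by
  rw [sum_antidiagonal_eq _ fun a b => if Odd b then f a b else 0, Finset.sum_range_succ,
    sum_range_two_mul, if_neg (by simp), add_zero]
  refine Finset.sum_congr rfl fun j _ => ?_
  rw [if_neg (by simp), if_pos (by simp), zero_add]
  congr 1
  omega

lemma sum_antidiagonal_even_of_even (p : ℕ) (f : ℕ → ℕ → ℝ) :
    ∑ ab ∈ Finset.HasAntidiagonal.antidiagonal (2 * p),
      (if Even ab.2 then f ab.1 ab.2 else 0) =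
      ∑ j ∈ Finset.range (p + 1), f (2 * p - 2 * j) (2 * j) := by
  rw [sum_antidiagonal_eq _ fun a b => if Even b then f a b else 0, Finset.sum_range_succ,
    sum_range_two_mul, if_pos (by simp), Finset.sum_range_succ]
  congr 1
  refine Finset.sum_congr rfl fun j _ => ?_
  rw [if_pos (by simp), if_neg (by simp), add_zero]

lemma altTTerm_converges_of_mem {w r : ℕ} (hr : 1 ≤ r) {k : Fin r → ℕ} (hk : k ∈ indexSet w r) :
    SeriesConverges (altTTerm r k) := by
  obtain ⟨r, rfl⟩ := Nat.exists_eq_add_of_le' hr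
  exact altTTerm_converges r k (mem_indexSet.1 hk).2

end AltMTV

end

theorem theorem2p3 (m p : ℕ) (hm : 1 ≤ m) (hp : 1 ≤ p) :
    -- all the series that occur converge
    ((∀ s : ℕ, 1 ≤ s → SeriesConverges (zetaBarTerm s)) ∧
      (∀ k ∈ indexSet (2 * p + 2 * m - 1) (2 * m), SeriesConverges (altTTerm (2 * m) k)) ∧
      (∀ k ∈ indexSet (2 * p + 2 * m - 2) (2 * m), SeriesConverges (altTTerm (2 * m) k)) ∧
      (∀ k ∈ indexSet (2 * p + 2 * m - 2) (2 * m - 1),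
        SeriesConverges (altTTerm (2 * m - 1) k)) ∧
      (∀ k ∈ indexSet (2 * p + 2 * m - 3) (2 * m - 1),
        SeriesConverges (altTTerm (2 * m - 1) k)) ∧
      (∀ j < p, SeriesConverges (termTTEven (2 * m - 1) (2 * j + 1))) ∧
      SeriesConverges (termTSEven (2 * m - 1) (2 * p - 2)) ∧
      (∀ j < p, SeriesConverges (termTTOdd (2 * m - 2) (2 * j))) ∧
      SeriesConverges (termTSOdd (2 * m - 2) (2 * p - 1))) ∧
    -- the four formulas
    W (2 * p + 2 * m - 1) (2 * m) =
      2 * (-1) ^ m * ∑ j ∈ Finset.range p,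
        zetaBar (2 * p - 2 - 2 * j) * series (termTTEven (2 * m - 1) (2 * j + 1)) ∧
    W (2 * p + 2 * m - 2) (2 * m) =
      2 * (-1) ^ m * ∑ j ∈ Finset.range (p - 1),
          zetaBar (2 * p - 3 - 2 * j) * series (termTTEven (2 * m - 1) (2 * j + 1)) +
        (-1) ^ m * series (termTSEven (2 * m - 1) (2 * p - 2)) ∧
    W (2 * p + 2 * m - 2) (2 * m - 1) =
      4 * (-1) ^ (m - 1) * ∑ j ∈ Finset.range p,
          zetaBar (2 * p - 1 - 2 * j) * series (termTTOdd (2 * m - 2) (2 * j)) +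
        2 * (-1) ^ (m - 1) * series (termTSOdd (2 * m - 2) (2 * p - 1)) ∧
    W (2 * p + 2 * m - 3) (2 * m - 1) =
      4 * (-1) ^ (m - 1) * ∑ j ∈ Finset.range p,
        zetaBar (2 * p - 2 - 2 * j) * series (termTTOdd (2 * m - 2) (2 * j)) := by
  -- With `p + 1` in place of `p`, the excess of weight over depth is `2p + 1`, `2p`, `2p + 1`, `2p`
  -- in the four formulas, so its parity decides whether an `S`-term is present.
  obtain ⟨p, rfl⟩ := Nat.exists_eq_add_of_le' hp
  refine ⟨⟨fun s hs => zetaBarTerm_converges hs,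
    fun k hk => altTTerm_converges_of_mem (by omega) hk,
    fun k hk => altTTerm_converges_of_mem (by omega) hk,
    fun k hk => altTTerm_converges_of_mem (by omega) hk,
    fun k hk => altTTerm_converges_of_mem (by omega) hk,
    fun j _ => termTTEven_converges _ _, termTSEven_converges _ _,
    fun j _ => termTTOdd_converges _ _, termTSOdd_converges _ _⟩, ?_, ?_, ?_, ?_⟩
  · rw [show 2 * (p + 1) + 2 * m - 1 = 2 * m + (2 * p + 1) by omega, W_even m _ hm,
      if_neg (by simp), add_zero,
      sum_antidiagonal_odd_of_odd p fun a b =>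
        2 * zetaBar a * series (termTTEven (2 * m - 1) b), Finset.mul_sum, Finset.mul_sum]
    refine Finset.sum_congr rfl fun j _ => ?_
    rw [show 2 * (p + 1) - 2 - 2 * j = 2 * p - 2 * j by omega]
    ring
  · rw [show 2 * (p + 1) + 2 * m - 2 = 2 * m + 2 * p by omega, W_even m _ hm,
      if_pos (by simp),
      sum_antidiagonal_odd_of_even p fun a b =>
        2 * zetaBar a * series (termTTEven (2 * m - 1) b), mul_add, Finset.mul_sum, Finset.mul_sum,
      Nat.add_sub_cancel, show 2 * (p + 1) - 2 = 2 * p by omega]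
    congr 1
    refine Finset.sum_congr rfl fun j _ => ?_
    rw [show 2 * (p + 1) - 3 - 2 * j = 2 * p - 1 - 2 * j by omega]
    ring
  · rw [show 2 * (p + 1) + 2 * m - 2 = 2 * m - 1 + (2 * p + 1) by omega, W_odd m _ hm,
      if_pos (by simp),
      sum_antidiagonal_even_of_odd p fun a b =>
        4 * zetaBar a * series (termTTOdd (2 * m - 2) b), mul_add, Finset.mul_sum, Finset.mul_sum,
      show 2 * (p + 1) - 1 = 2 * p + 1 by omega]
    congr 1
    · exact Finset.sum_congr rfl fun j _ => by ring
    · ring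
  · rw [show 2 * (p + 1) + 2 * m - 3 = 2 * m - 1 + 2 * p by omega, W_odd m _ hm,
      if_neg (by simp), add_zero,
      sum_antidiagonal_even_of_even p fun a b =>
        4 * zetaBar a * series (termTTOdd (2 * m - 2) b), Finset.mul_sum, Finset.mul_sum]
    refine Finset.sum_congr rfl fun j _ => ?_
    rw [show 2 * (p + 1) - 2 - 2 * j = 2 * p - 2 * j by omega]
    ring
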